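/- Let $R$ be a commutative ring with an automorphism $x\mapsto\bar x$ and elements $\lambda,\mu\in R$ such that $\bar{\bar x}=\lambda x\bar\lambda$ for all $x\in R$ and $\mu=\bar\mu\lambda$ (so $\bar\lambda=\lambda^{-1}$). Let $\mathfrak H=R\times R$ be the group with operation $(x_1,y_1)\dotplus(x_2,y_2)=(x_1+x_2,\,y_1+y_2-\bar x_1\mu x_2)$, and set $(x,y)\circ a=(xa,\bar a y a)$. Let $\Delta$ be an odd form parameter, i.e. a subgroup of $\mathfrak H$ that is stable under $\circ a$ for all $a\in R$ and satisfies $\{(0,x-\bar x\lambda)\mid x\in R\}\subseteq\Delta\subseteq\{(x,y)\mid \bar x\mu x+y+\bar y\lambda=0\}$. Put $J(\Delta)=\{x\in R\mid \exists\, y\in R:\ (x,y)\in\Delta\}$, $\Delta^{1}=\Delta$ and $\Delta^{-1}=\{(x,y)\mid (x,\bar y)\in\Delta\}$. Let $n\ge 3$, $\Theta_{hb}=\{1,\dots,n,-n,\dots,-1\}$ and $\Theta=\Theta_{hb}\cup\{0\}$; for $i\in\Theta_{hb}$ let $\epsilon(i)=1$ if $i>0$ and $\epsilon(i)=-1$ if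 $i<0$. Vectors $u\in R^{2n+1}$ and matrices of size $2n+1$ are indexed by $\Theta$. Let $$b(u,v)=\sum_{i=1}^n\bar u_iv_{-i}+\bar u_0\mu v_0+\sum_{i=1}^n\bar u_{-i}\lambda v_{i},\qquad q(u)=(q_1(u),q_2(u))=\Big(u_0,\ \sum_{i=1}^n\bar u_iu_{-i}\Big)\in\mathfrak H,$$ and let $U_{2n+1}(R,\Delta)$ be the group of all $\sigma\in GL_{2n+1}(R)$ such that $b(\sigma u,\sigma v)=b(u,v)$ and $q(\sigma u)\equiv q(u)\bmod\Delta$ for all $u,v\in R^{2n+1}$. With $e$ the identity matrix and $e^{ij}$ the matrix units, put $$T_{ij}(x)=e+xe^{ij}-\lambda^{(\epsilon(j)-1)/2}\,\bar x\,\lambda^{(1-\epsilon(i))/2}e^{-j,-i}\qquad(i,j\in\Theta_{hb},\ i\ne\pm j,\ x\in R),$$ $$T_i(x,y)=e+xe^{0,-i}-\lambda^{-(1+\epsilon(i))/2}\,\bar x\mu\, e^{i0}+ye^{i,-i}\qquad(i\in\Theta_{hb},\ (x,y)\in\Delta^{-\epsilon(i)}).$$ Let $EU_{2n+1}(R,\Delta)$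 be the subgroup of $U_{2n+1}(R,\Delta)$ generated by all these matrices. For $\sigma\in U_{2n+1}(R,\Delta)$, an elementary unitary $\sigma$-conjugate is a matrix $\varepsilon\sigma^{\pm1}\varepsilon^{-1}$ with $\varepsilon\in EU_{2n+1}(R,\Delta)$. Theorem. Let $\sigma\in U_{2n+1}(R,\Delta)$, let $i,j,k,l\in\Theta_{hb}$ with $i\ne\pm j$ and $k\ne\pm l$, and let $a\in J(\Delta)$. Write $\sigma_{*j}$ for the $j$-th column of $\sigma$. Then (i) $T_{kl}(\sigma_{ij})$ is a product of $160$ elementary unitary $\sigma$-conjugates; (ii) $T_{kl}(\sigma_{i,-i})$ is a product of $320$ elementary unitary $\sigma$-conjugates; (iii) $T_{kl}(\sigma_{i0}a)$ is a product of $480$ elementary unitary $\sigma$-conjugates; (iv) $T_{kl}(\bar a\mu\sigma_{0j})$ is a product of $480$ elementary unitary $\sigma$-conjugates; (v) $T_{kl}(\sigma_{ii}-\sigma_{jj})$ is a product of $480$ elementary unitary $\sigma$-conjugates; (vi) $T_{kl}(\sigma_{ii}-\sigma_{-i,-i})$ is a product of $960$ elementary unitary $\sigma$-conjugates; (vii)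 $\big(q_1(\sigma_{*j}),\lambda^{-(\epsilon(k)+1)/2}q_2(\sigma_{*j})\big)\in\Delta^{-\epsilon(k)}$, and $T_k\big(q_1(\sigma_{*j}),\lambda^{-(\epsilon(k)+1)/2}q_2(\sigma_{*j})\big)$ is a product of $1600n+5764$ elementary unitary $\sigma$-conjugates; (viii) there is an $x\in R$ with $\big((\sigma_{00}-\sigma_{jj})a,x\big)\in\Delta^{-\epsilon(k)}$ such that $T_k\big((\sigma_{00}-\sigma_{jj})a,x\big)$ is a product of $4800n+16812$ elementary unitary $\sigma$-conjugates. -/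

import Mathlib

namespace OddUnitary

/-- A Hermitian ring `(R, bar, lam, mu)` over a commutative ring `R`. As `R` is commutative, an
anti-isomorphism of `R` is the same thing as a ring automorphism of `R`. -/
structure HermitianRing (R : Type*) [CommRing R] where
  bar : R ≃+* R
  lam : R
  mu : R
  bar_bar : ∀ x : R, bar (bar x) = lam * x * bar lam
  mu_eq : mu = bar mu * lam

namespace HermitianRing

variable {R : Type*} [CommRing R] (H : HermitianRing R)

theorem lam_mul_bar_lam : H.lam * H.bar H.lam = 1 := by
  have h := H.bar_bar 1
  simpa using h.symm

theorem bar_lam_mul_lam : H.bar H.lam * H.lam = 1 := by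
  rw [mul_comm]
  exact H.lam_mul_bar_lam

/-- The symmetry as a unit of `R` (its inverse is `bar lam`), so that its integer powers make
sense. -/
def lamUnit : Rˣ := ⟨H.lam, H.bar H.lam, H.lam_mul_bar_lam, H.bar_lam_mul_lam⟩

/-- The integer power `lam ^ z`. -/
def lamPow (z : ℤ) : R := ((H.lamUnit ^ z : Rˣ) : R)

end HermitianRing

/-- The underlying set `R × R` of the Heisenberg group of a Hermitian ring. -/
@[ext]
structure Heisenberg {R : Type*} [CommRing R] (H : HermitianRing R) where
  fst : R
  snd : R

namespace Heisenberg

variable {R : Type*} [CommRing R] {H : HermitianRing R}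

instance : Add (Heisenberg H) :=
  ⟨fun a c => ⟨a.fst + c.fst, a.snd + c.snd - H.bar a.fst * H.mu * c.fst⟩⟩

instance : Zero (Heisenberg H) := ⟨⟨0, 0⟩⟩

instance : Neg (Heisenberg H) :=
  ⟨fun a => ⟨-a.fst, -a.snd - H.bar a.fst * H.mu * a.fst⟩⟩

theorem add_def (a c : Heisenberg H) :
    a + c = ⟨a.fst + c.fst, a.snd + c.snd - H.bar a.fst * H.mu * c.fst⟩ := rfl

theorem zero_def : (0 : Heisenberg H) = ⟨0, 0⟩ := rfl

theorem neg_def (a : Heisenberg H) :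
    -a = ⟨-a.fst, -a.snd - H.bar a.fst * H.mu * a.fst⟩ := rfl

/-- The Heisenberg group, written additively although it is in general not commutative. -/
instance : AddGroup (Heisenberg H) :=
  AddGroup.ofLeftAxioms
    (by
      intro a c d
      simp only [add_def, map_add]
      ext
      · ring
      · ring)
    (by
      intro a
      simp only [add_def, zero_def, map_zero]
      ext
      · ring
      · ring)
    (by
      intro a
      simp only [add_def, zero_def, neg_def, map_neg]
      ext
      · ring
      · ring)

/-- The scalar multiplication `(x, y) ∘ a = (x a, bar a * y * a)`. -/
def circ (p : Heisenberg H) (a : R) : Heisenberg H :=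
  ⟨p.fst * a, H.bar a * p.snd * a⟩

/-- The trace map. -/
def tr (p : Heisenberg H) : R :=
  H.bar p.fst * H.mu * p.fst + p.snd + H.bar p.snd * H.lam

variable (H) in
/-- The smallest odd form parameter. -/
def deltaMin : Set (Heisenberg H) := {p | ∃ x : R, p = ⟨0, x - H.bar x * H.lam⟩}

variable (H) in
/-- The largest odd form parameter, the kernel of the trace map. -/
def deltaMax : Set (Heisenberg H) := {p | tr p = 0}

end Heisenberg

/-- An odd form parameter: a subgroup of the Heisenberg group that is stable under the scalar
multiplication and lies between `deltaMin` and `deltaMax`. A Hermitian form ring is a Hermitian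
ring together with an odd form parameter. -/
structure OddFormParameter {R : Type*} [CommRing R] (H : HermitianRing R) where
  carrier : AddSubgroup (Heisenberg H)
  circ_mem : ∀ p ∈ carrier, ∀ a : R, p.circ a ∈ carrier
  min_le : Heisenberg.deltaMin H ⊆ (carrier : Set (Heisenberg H))
  le_max : (carrier : Set (Heisenberg H)) ⊆ Heisenberg.deltaMax H

namespace OddFormParameter

variable {R : Type*} [CommRing R] {H : HermitianRing R} (Δ : OddFormParameter H)

/-- `J(Δ)`, the set of first coordinates of elements of `Δ`. -/
def J : Set R := {y | ∃ z : R, (⟨y, z⟩ : Heisenberg H) ∈ Δ.carrier}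

/-- The sets `Δ^1 = Δ` and `Δ^(-1) = {(x, y) | (x, bar y) ∈ Δ}`. -/
def signed (s : ℤˣ) : Set (R × R) :=
  if s = 1 then {p | (⟨p.1, p.2⟩ : Heisenberg H) ∈ Δ.carrier}
  else {p | (⟨p.1, H.bar p.2⟩ : Heisenberg H) ∈ Δ.carrier}

end OddFormParameter

/-- The set `{1, …, n} ∪ {-n, …, -1}` of nonzero indices: `Sum.inl r` stands for the index `r + 1`
and `Sum.inr r` for the index `-(r + 1)`. -/
abbrev Hb (n : ℕ) : Type := Fin n ⊕ Fin n

/-- The set `{1, …, n, 0, -n, …, -1}` of all indices: `none` stands for the index `0`. -/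
abbrev Idx (n : ℕ) : Type := Option (Hb n)

/-- The index `-i`. -/
def opp {n : ℕ} (i : Hb n) : Hb n := Sum.swap i

/-- The sign of a nonzero index. -/
def eps {n : ℕ} : Hb n → ℤˣ
  | Sum.inl _ => 1
  | Sum.inr _ => -1

section Unitary

variable {R : Type*} [CommRing R] (H : HermitianRing R) {n : ℕ}

/-- The `lam`-Hermitian form `b` on `R^(2n+1)`. -/
def form (u v : Idx n → R) : R :=
  ∑ r : Fin n, H.bar (u (some (Sum.inl r))) * v (some (Sum.inr r))
    + H.bar (u none) * H.mu * v none
    + ∑ r : Fin n, H.bar (u (some (Sum.inr r))) * H.lam * v (some (Sum.inl r))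

/-- The map `q = (q₁, q₂)` from `R^(2n+1)` to the Heisenberg group. -/
def quad (u : Idx n → R) : Heisenberg H :=
  ⟨u none, ∑ r : Fin n, H.bar (u (some (Sum.inl r))) * u (some (Sum.inr r))⟩

variable {H}

/-- The odd-dimensional unitary group `U_{2n+1}(R, Δ)`. -/
def unitaryGroup (n : ℕ) (Δ : OddFormParameter H) :
    Subgroup (Matrix.GeneralLinearGroup (Idx n) R) where
  carrier := {σ |
    (∀ u v : Idx n → R, form H (σ.1.mulVec u) (σ.1.mulVec v) = form H u v) ∧
    ∀ u : Idx n → R, quad H (σ.1.mulVec u) - quad H u ∈ Δ.carrier}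
  one_mem' := by
    refine ⟨fun u v => by simp, fun u => ?_⟩
    simp [Δ.carrier.zero_mem]
  mul_mem' := by
    intro σ τ hσ hτ
    refine ⟨fun u v => ?_, fun u => ?_⟩
    · rw [Units.val_mul, ← Matrix.mulVec_mulVec, ← Matrix.mulVec_mulVec, hσ.1, hτ.1]
    · have h := Δ.carrier.add_mem (hσ.2 (τ.1.mulVec u)) (hτ.2 u)
      rw [sub_add_sub_cancel] at h
      rwa [Units.val_mul, ← Matrix.mulVec_mulVec]
  inv_mem' := by
    intro σ hσ
    have key : ∀ u : Idx n → R, σ.1.mulVec ((σ⁻¹).1.mulVec u) = u := by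
      intro u
      rw [Matrix.mulVec_mulVec, ← Units.val_mul, mul_inv_cancel, Units.val_one,
        Matrix.one_mulVec]
    refine ⟨fun u v => ?_, fun u => ?_⟩
    · have h := hσ.1 ((σ⁻¹).1.mulVec u) ((σ⁻¹).1.mulVec v)
      rw [key, key] at h
      exact h.symm
    · have h := Δ.carrier.neg_mem (hσ.2 ((σ⁻¹).1.mulVec u))
      rw [key, neg_sub] at h
      exact h

variable (H)

/-- The matrix
`T_{ij}(x) = e + x e^{ij} - lam^((ε(j)-1)/2) (bar x) lam^((1-ε(i))/2) e^{-j,-i}`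
(meant for `i ≠ ± j`). -/
def shortRoot (i j : Hb n) (x : R) : Matrix (Idx n) (Idx n) R :=
  1 + Matrix.single (some i) (some j) x
    - Matrix.single (some (opp j)) (some (opp i))
        (H.lamPow (((eps j : ℤ) - 1) / 2) * H.bar x * H.lamPow ((1 - (eps i : ℤ)) / 2))

/-- The matrix
`T_i(x, y) = e + x e^{0,-i} - lam^(-(1+ε(i))/2) (bar x) mu e^{i0} + y e^{i,-i}`
(meant for `(x, y) ∈ Δ^(-ε(i))`). -/
def extraShortRoot (i : Hb n) (x y : R) : Matrix (Idx n) (Idx n) R :=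
  1 + Matrix.single none (some (opp i)) x
    - Matrix.single (some i) none
        (H.lamPow (-((1 + (eps i : ℤ)) / 2)) * H.bar x * H.mu)
    + Matrix.single (some i) (some (opp i)) y

variable {H}

/-- Short and extra short root matrices, which together are the elementary matrices. -/
def IsElementaryMatrix (Δ : OddFormParameter H) (A : Matrix (Idx n) (Idx n) R) : Prop :=
  (∃ (i j : Hb n) (x : R), i ≠ j ∧ i ≠ opp j ∧ A = shortRoot H i j x) ∨
  ∃ (i : Hb n) (x y : R), (x, y) ∈ Δ.signed (-eps i) ∧ A = extraShortRoot H i x y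

/-- The elementary subgroup `EU_{2n+1}(R, Δ)`. -/
def elementaryGroup (n : ℕ) (Δ : OddFormParameter H) :
    Subgroup (Matrix.GeneralLinearGroup (Idx n) R) :=
  Subgroup.closure {g | g ∈ unitaryGroup n Δ ∧ IsElementaryMatrix Δ g.1}

/-- `τ` is an elementary unitary `σ`-conjugate. -/
def IsElementaryConjugate (Δ : OddFormParameter H)
    (σ τ : Matrix.GeneralLinearGroup (Idx n) R) : Prop :=
  ∃ g ∈ elementaryGroup n Δ, τ = g * σ * g⁻¹ ∨ τ = g * σ⁻¹ * g⁻¹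

/-- The matrix `A` is a product of exactly `N` elementary unitary `σ`-conjugates. -/
def IsProductOfConjugates (Δ : OddFormParameter H) (σ : Matrix.GeneralLinearGroup (Idx n) R)
    (N : ℕ) (A : Matrix (Idx n) (Idx n) R) : Prop :=
  ∃ L : List (Matrix.GeneralLinearGroup (Idx n) R),
    L.length = N ∧ (∀ τ ∈ L, IsElementaryConjugate Δ σ τ) ∧ L.prod.1 = A

end Unitary

end OddUnitary

/-!
Throughout, `b` is the form, `E(u, v)` the Eichler transformation
`w ↦ w + b(v, w) u - lam⁻¹ b(u, w) v` of an orthogonal pair of isotropic vectors, and `X_k(p)`, for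
`p ∈ Δ`, the transformation `extra k p`. The elementary matrices are the `E(x e_k, e_l)` and the
`X_k(p)`; conjugation by a unitary matrix `g` turns `E(u, v)` into `E(g u, g v)`. Call an element
`z` of `R` controlled if, for all short roots, the short root elements with parameters in `R z` are
products of a fixed number of elementary conjugates (`ShortBound`). Controlled elements form an
ideal closed under `bar`, with numbers of factors that add up, and the Weyl group makes it
sufficient to look at a single root.

*Products of entries in a row.* The vectors `u = σ_ij e_i - σ_ii e_j` and `v = σ_ij e_m - σ_im e_j`
are orthogonal to `σ⁻¹ e_{-i}`. Hence `τ = E(u, v)` is elementary and `σ τ σ⁻¹` fixes `e_{-i}`. The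
commutator of `τ (σ τ⁻¹ σ⁻¹)` with `E(e_{-i}, a)` is, up to conjugation, a product of a known matrix
and of a matrix `E(e_{-i}, ·)`, and two further commutators eliminate the latter
(`ProdConj.commutator_commutator`). This controls `σ_ij bar σ_im` (`shortBound_row_off`), and a
variant controls `σ_ii bar σ_ij` (`shortBound_row_diag`).

*Entries.* Let `φ` be the commutator of `σ⁻¹` with a short root element whose parameter `s` is
essentially `bar σ_ij`. Modulo the products of entries above, some entry `φ_pi` is `s φ_pp` up to a
unit, and `s φ_pp bar φ_pp` is `s`. As `φ_pp bar φ_pi` is controlled, so are `s` and `σ_ij`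
(`shortBound_entry`). Conjugating `σ` by elementary matrices, one obtains the other short root
parameters of the theorem from entries of the conjugate.

*Columns.* Let `u'` be the combination of the columns `j` and `i` of `σ` whose coordinate `i`
vanishes, with coefficients `σ_ii` and `-σ_ij`. By a similar commutator, `E(e_{-i}, α u')` is a
bounded product up to a known factor, for multiples `α` of a minor of `σ` (`ProdConj.plane`). All
coordinates of `α u'`, corrected by that factor, are controlled; stripping them off one by one, at
a cost linear in `n`, leaves the element `X_{-i}(q(α u'))` (`prodConj_quad_planeVec`). Since
`α σ_ij` is controlled, this amounts to `X_{-i}(q(σ e_j) ∘ s)` with `s = α σ_ii`. As `σ_jj` is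
inverse to `bar σ_mm` modulo controlled elements (`shortBound_one_sub`), `α` can be chosen such
that `s` is any given scalar modulo controlled elements (`prodConj_quad_column`). The last
parameter is read off from column `j` of the conjugate of `σ` by `X_{-j}(p)`, where `p ∈ Δ` has
first coordinate `a` (`exists_prodConj_zero_sub`).
-/

namespace OddUnitary

open Matrix

/-! ### Basis vectors and the form -/

section Form

variable {R : Type*} [CommRing R] (H : HermitianRing R) {n : ℕ}

namespace HermitianRing

@[simp] theorem bar_bar_eq (x : R) : H.bar (H.bar x) = x := by
  rw [H.bar_bar]
  linear_combination x * H.lam_mul_bar_lam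

theorem bar_mu : H.bar H.mu = H.mu * H.bar H.lam := by
  have h := H.mu_eq
  linear_combination (-H.bar H.lam) * h - H.bar H.mu * H.lam_mul_bar_lam

/-- The value `b(e_k, e_{-k})`, which is `1` or `lam` according to the sign of `k`. -/
def theta : Hb n → R
  | Sum.inl _ => 1
  | Sum.inr _ => H.lam

theorem theta_mul_bar (k : Hb n) : H.theta k * H.bar (H.theta k) = 1 := by
  rcases k with k | k
  · simp [theta]
  · exact H.lam_mul_bar_lam

theorem theta_opp (k : Hb n) : H.theta (opp k) = H.lam * H.bar (H.theta k) := by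
  rcases k with k | k
  · simp [theta, opp]
  · simp [theta, opp, H.lam_mul_bar_lam]

end HermitianRing

@[simp] theorem opp_opp (k : Hb n) : opp (opp k) = k := by simp [opp]

theorem opp_ne_self (k : Hb n) : opp k ≠ k := by
  rcases k with k | k <;> simp [opp]

theorem opp_inj {k l : Hb n} : opp k = opp l ↔ k = l :=
  ⟨fun h => by rw [← opp_opp k, h, opp_opp], fun h => by rw [h]⟩

theorem opp_eq_iff {k l : Hb n} : opp k = l ↔ k = opp l :=
  ⟨fun h => by rw [← h, opp_opp], fun h => by rw [h, opp_opp]⟩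

/-- The basis vector with nonzero index `k`. -/
def ee (k : Hb n) : Idx n → R := Pi.single (some k) 1

/-- The basis vector with index `0`. -/
def e0 : Idx n → R := Pi.single none 1

@[simp] theorem ee_self (k : Hb n) : (ee k : Idx n → R) (some k) = 1 := by simp [ee]

theorem ee_ne {k l : Hb n} (h : l ≠ k) : (ee k : Idx n → R) (some l) = 0 := by simp [ee, h]

@[simp] theorem ee_none (k : Hb n) : (ee k : Idx n → R) none = 0 := by simp [ee]

@[simp] theorem e0_some (k : Hb n) : (e0 : Idx n → R) (some k) = 0 := by simp [e0]

@[simp] theorem e0_none : (e0 : Idx n → R) none = 1 := by simp [e0]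

theorem form_add_left (u u' v : Idx n → R) :
    form H (u + u') v = form H u v + form H u' v := by
  simp only [form, Pi.add_apply, map_add, add_mul, Finset.sum_add_distrib]
  ring

theorem form_add_right (u v v' : Idx n → R) :
    form H u (v + v') = form H u v + form H u v' := by
  simp only [form, Pi.add_apply, mul_add, Finset.sum_add_distrib]
  ring

theorem form_smul_left (c : R) (u v : Idx n → R) :
    form H (c • u) v = H.bar c * form H u v := by
  simp only [form, Pi.smul_apply, smul_eq_mul, map_mul, mul_add, Finset.mul_sum, mul_assoc]

theorem form_smul_right (c : R) (u v : Idx n → R) :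
    form H u (c • v) = c * form H u v := by
  simp only [form, Pi.smul_apply, smul_eq_mul, mul_add, Finset.mul_sum]
  refine congrArg₂ _ (congrArg₂ _ (Finset.sum_congr rfl fun r _ => ?_) ?_)
    (Finset.sum_congr rfl fun r _ => ?_) <;> ring

theorem form_neg_left (u v : Idx n → R) : form H (-u) v = -form H u v := by
  rw [← neg_one_smul R u, form_smul_left]; simp

theorem form_neg_right (u v : Idx n → R) : form H u (-v) = -form H u v := by
  rw [← neg_one_smul R v, form_smul_right]; simp

theorem form_sub_left (u u' v : Idx n → R) :
    form H (u - u') v = form H u v - form H u' v := by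
  rw [sub_eq_add_neg, form_add_left, form_neg_left, sub_eq_add_neg]

theorem form_sub_right (u v v' : Idx n → R) :
    form H u (v - v') = form H u v - form H u v' := by
  rw [sub_eq_add_neg, form_add_right, form_neg_right, sub_eq_add_neg]

@[simp] theorem form_zero_left (v : Idx n → R) : form H 0 v = 0 := by simp [form]

@[simp] theorem form_zero_right (v : Idx n → R) : form H v 0 = 0 := by simp [form]

/-- The form `b` is `lam`-Hermitian. -/
theorem form_symm (u v : Idx n → R) : form H v u = H.bar (form H u v) * H.lam := by
  simp only [form, map_add, map_sum, map_mul, H.bar_bar_eq, add_mul, Finset.sum_mul]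
  have h1 : H.bar H.lam * H.lam = 1 := H.bar_lam_mul_lam
  have h2 : H.bar H.mu * H.lam = H.mu := H.mu_eq.symm
  rw [add_comm (_ + _), ← add_assoc, add_right_comm]
  refine congrArg₂ _ (congrArg₂ _ (Finset.sum_congr rfl fun r _ => ?_) ?_)
    (Finset.sum_congr rfl fun r _ => ?_)
  · ring
  · linear_combination (-(u none * H.bar (v none))) * h2
  · linear_combination (-(u (some (Sum.inr r)) * H.bar (v (some (Sum.inl r))))) * h1

theorem form_eq_zero_symm {u v : Idx n → R} (h : form H u v = 0) : form H v u = 0 := by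
  rw [form_symm H u v, h]; simp

theorem form_ee_left (k : Hb n) (w : Idx n → R) :
    form H (ee k) w = H.theta k * w (some (opp k)) := by
  rcases k with k | k <;>
  · simp only [form, ee, HermitianRing.theta, opp, Sum.swap]
    simp [Pi.single_apply, apply_ite H.bar, Finset.sum_ite_eq', ite_mul]

theorem form_ee_right (k : Hb n) (w : Idx n → R) :
    form H w (ee k) = H.bar (w (some (opp k))) * H.theta (opp k) := by
  rw [form_symm H (ee k) w, form_ee_left, map_mul, H.theta_opp]
  ring

theorem form_e0_left (w : Idx n → R) : form H e0 w = H.mu * w none := by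
  simp [form, e0]

theorem form_e0_right (w : Idx n → R) : form H w e0 = H.bar (w none) * H.mu := by
  simp [form, e0]

theorem form_opp_ee (k : Hb n) : form H (ee (opp k)) (ee k) = H.theta (opp k) := by
  rw [form_ee_left]; simp

theorem form_ee_ne {k l : Hb n} (h : k ≠ opp l) : form H (ee k) (ee l) = 0 := by
  rw [form_ee_left, ee_ne, mul_zero]
  rwa [Ne, opp_eq_iff]

@[simp] theorem form_ee_self (k : Hb n) : form H (ee k) (ee k) = 0 :=
  form_ee_ne H (opp_ne_self k).symm

@[simp] theorem form_ee_e0 (k : Hb n) : form H (ee k) e0 = 0 := by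
  rw [form_ee_left]; simp

@[simp] theorem form_e0_ee (k : Hb n) : form H e0 (ee k) = 0 := by
  rw [form_e0_left]; simp

@[simp] theorem form_e0_e0 : form H (e0 : Idx n → R) e0 = H.mu := by
  rw [form_e0_left]; simp

end Form

/-! ### Eichler transformations -/

section Eichler

variable {R : Type*} [CommRing R] {H : HermitianRing R} {n : ℕ}

/-- The action of an invertible matrix on column vectors. -/
def act (g : GeneralLinearGroup (Idx n) R) (w : Idx n → R) : Idx n → R := g.1 *ᵥ w

theorem act_add (g : GeneralLinearGroup (Idx n) R) (u v : Idx n → R) :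
    act g (u + v) = act g u + act g v := mulVec_add _ _ _

theorem act_sub (g : GeneralLinearGroup (Idx n) R) (u v : Idx n → R) :
    act g (u - v) = act g u - act g v := mulVec_sub _ _ _

theorem act_smul (g : GeneralLinearGroup (Idx n) R) (c : R) (v : Idx n → R) :
    act g (c • v) = c • act g v := mulVec_smul _ _ _

theorem act_neg (g : GeneralLinearGroup (Idx n) R) (v : Idx n → R) :
    act g (-v) = -act g v := mulVec_neg _ _

theorem act_zero (g : GeneralLinearGroup (Idx n) R) : act g 0 = 0 := mulVec_zero _

@[simp] theorem act_one (v : Idx n → R) : act (1 : GeneralLinearGroup (Idx n) R) v = v :=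
  one_mulVec _

theorem act_mul (g h : GeneralLinearGroup (Idx n) R) (v : Idx n → R) :
    act (g * h) v = act g (act h v) := by
  simp [act, mulVec_mulVec]

@[simp] theorem act_act_inv (g : GeneralLinearGroup (Idx n) R) (v : Idx n → R) :
    act g (act g⁻¹ v) = v := by
  rw [← act_mul]; simp

@[simp] theorem act_inv_act (g : GeneralLinearGroup (Idx n) R) (v : Idx n → R) :
    act g⁻¹ (act g v) = v := by
  rw [← act_mul]; simp

theorem act_inv_fix {g : GeneralLinearGroup (Idx n) R} {w : Idx n → R} (h : act g w = w) :
    act g⁻¹ w = w := by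
  nth_rewrite 1 [← h]
  rw [act_inv_act]

theorem act_ext {g h : GeneralLinearGroup (Idx n) R} (hgh : ∀ v, act g v = act h v) : g = h := by
  apply Units.ext
  exact Matrix.ext_of_mulVec_single fun i => hgh _

theorem act_ee (g : GeneralLinearGroup (Idx n) R) (k : Hb n) (r : Idx n) :
    act g (ee k) r = g.1 r (some k) := by
  simp [act, ee]

theorem act_e0 (g : GeneralLinearGroup (Idx n) R) (r : Idx n) :
    act g e0 r = g.1 r none := by
  simp [act, e0]

/-- The matrix `g` preserves the form `b`. -/
def Preserves (H : HermitianRing R) (g : GeneralLinearGroup (Idx n) R) : Prop :=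
  ∀ u v, form H (act g u) (act g v) = form H u v

theorem Preserves.inv {g : GeneralLinearGroup (Idx n) R} (hg : Preserves H g) :
    Preserves H g⁻¹ := fun u v => by
  rw [← hg]; simp

theorem Preserves.mul {g h : GeneralLinearGroup (Idx n) R} (hg : Preserves H g)
    (hh : Preserves H h) : Preserves H (g * h) := fun u v => by
  rw [act_mul, act_mul, hg, hh]

theorem Preserves.form_act_left {g : GeneralLinearGroup (Idx n) R} (hg : Preserves H g)
    (u v : Idx n → R) : form H (act g u) v = form H u (act g⁻¹ v) := by
  rw [← hg u]; simp

variable (H) in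
/-- The linear form `w ↦ b(v, w)`. -/
def formLin (v : Idx n → R) : (Idx n → R) →ₗ[R] R where
  toFun w := form H v w
  map_add' := form_add_right H v
  map_smul' c w := form_smul_right H c v w

variable (H) in
/-- The endomorphism underlying `eichler`. -/
def eichlerLin (e v : Idx n → R) (κ : R) : (Idx n → R) →ₗ[R] (Idx n → R) :=
  LinearMap.id + (formLin H v).smulRight e - H.bar H.lam • (formLin H e).smulRight v
    + κ • (formLin H e).smulRight e

theorem eichlerLin_apply (e v w : Idx n → R) (κ : R) :
    eichlerLin H e v κ w
      = w + form H v w • e - (H.bar H.lam * form H e w) • v + (κ * form H e w) • e := by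
  simp [eichlerLin, formLin, smul_smul]

theorem eichlerLin_comp {e v v' : Idx n → R} (κ κ' : R) (he : form H e e = 0)
    (hv : form H e v = 0) (hv' : form H e v' = 0) :
    eichlerLin H e v κ ∘ₗ eichlerLin H e v' κ'
      = eichlerLin H e (v + v') (κ + κ' - H.bar H.lam * form H v v') := by
  refine LinearMap.ext fun w => ?_
  have h1 := form_eq_zero_symm H hv
  simp only [LinearMap.comp_apply, eichlerLin_apply, form_add_right, form_sub_right,
    form_smul_right, form_add_left, he, hv', h1]
  module

theorem eichlerLin_zero (e : Idx n → R) : eichlerLin H e 0 0 = LinearMap.id := by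
  refine LinearMap.ext fun w => ?_
  simp [eichlerLin_apply]

open Classical in
variable (H) in
/-- The Eichler transformation
`w ↦ w + b(v, w) e - lam⁻¹ b(e, w) v + κ b(e, w) e`, where `e` is isotropic and `v` is orthogonal
to `e`. It is the identity, by convention, for all other `e` and `v`. It preserves `b` if `κ`
is suitable; `κ = 0` is suitable when `v` is isotropic. In comments, `E(e, v)` stands for
`eichler H e v 0`. -/
noncomputable def eichler (e v : Idx n → R) (κ : R) : GeneralLinearGroup (Idx n) R :=
  if h : form H e e = 0 ∧ form H e v = 0 then
    ⟨LinearMap.toMatrix' (eichlerLin H e v κ),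
      LinearMap.toMatrix' (eichlerLin H e (-v) (-κ - H.bar H.lam * form H v v)),
      by
        rw [← LinearMap.toMatrix'_comp, eichlerLin_comp κ _ h.1 h.2 (by
          rw [form_neg_right, h.2, neg_zero])]
        rw [add_neg_cancel, form_neg_right]
        ring_nf
        rw [eichlerLin_zero, LinearMap.toMatrix'_id],
      by
        rw [← LinearMap.toMatrix'_comp, eichlerLin_comp _ κ h.1 (by
          rw [form_neg_right, h.2, neg_zero]) h.2]
        rw [neg_add_cancel, form_neg_left]
        ring_nf
        rw [eichlerLin_zero, LinearMap.toMatrix'_id]⟩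
  else 1

theorem act_eichler {e v : Idx n → R} (κ : R) (he : form H e e = 0) (hv : form H e v = 0)
    (w : Idx n → R) : act (eichler H e v κ) w
      = w + form H v w • e - (H.bar H.lam * form H e w) • v + (κ * form H e w) • e := by
  rw [← eichlerLin_apply]
  simp only [act, eichler, he, hv, and_self, dif_pos]
  exact LinearMap.toMatrix'_mulVec _ _

theorem eichler_act_fix {u v w : Idx n → R} (hu : form H u u = 0) (huv : form H u v = 0)
    (h1 : form H u w = 0) (h2 : form H v w = 0) : act (eichler H u v 0) w = w := by
  rw [act_eichler _ hu huv, h1, h2]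
  simp

theorem eichler_mul {e v v' : Idx n → R} (κ κ' : R) (he : form H e e = 0)
    (hv : form H e v = 0) (hv' : form H e v' = 0) :
    eichler H e v κ * eichler H e v' κ'
      = eichler H e (v + v') (κ + κ' - H.bar H.lam * form H v v') := by
  apply act_ext
  intro w
  have h := congrArg (fun f => f w) (eichlerLin_comp κ κ' he hv hv')
  simp only [LinearMap.comp_apply] at h
  rw [act_mul, act_eichler _ he hv', act_eichler _ he hv, act_eichler _ he (by
    rw [form_add_right, hv, hv', add_zero]), ← eichlerLin_apply, ← eichlerLin_apply,
    ← eichlerLin_apply, h]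

theorem eichler_zero (e : Idx n → R) : eichler H e 0 0 = 1 := by
  by_cases he : form H e e = 0
  · apply act_ext
    intro w
    rw [act_eichler _ he (by simp)]
    simp
  · simp [eichler, he]

theorem eichler_inv {e v : Idx n → R} (κ : R) (he : form H e e = 0) (hv : form H e v = 0) :
    (eichler H e v κ)⁻¹ = eichler H e (-v) (-κ - H.bar H.lam * form H v v) := by
  rw [inv_eq_iff_mul_eq_one, eichler_mul _ _ he hv (by rw [form_neg_right, hv, neg_zero]),
    add_neg_cancel, form_neg_right]
  ring_nf
  exact eichler_zero e

/-- Conjugates of Eichler transformations are Eichler transformations. -/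
theorem eichler_conj {g : GeneralLinearGroup (Idx n) R} (hg : Preserves H g)
    (e v : Idx n → R) (κ : R) :
    g * eichler H e v κ * g⁻¹ = eichler H (act g e) (act g v) κ := by
  by_cases h : form H e e = 0 ∧ form H e v = 0
  · apply act_ext
    intro w
    rw [act_eichler _ ((hg _ _).trans h.1) ((hg _ _).trans h.2), act_mul, act_mul,
      act_eichler _ h.1 h.2]
    simp only [act_add, act_sub, act_smul, act_act_inv, hg.form_act_left]
  · have h' : ¬ (form H (act g e) (act g e) = 0 ∧ form H (act g e) (act g v) = 0) := by
      rwa [hg, hg]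
    simp [eichler, h, h']

theorem eichler_smul_left {u v : Idx n → R} (c : R) (hu : form H u u = 0) (huv : form H u v = 0) :
    eichler H (c • u) v 0 = eichler H u (H.bar c • v) 0 := by
  apply act_ext
  intro w
  rw [act_eichler _ (by simp [form_smul_left, form_smul_right, hu])
    (by simp [form_smul_left, huv]), act_eichler _ hu (by simp [form_smul_right, huv])]
  simp only [form_smul_left, H.bar_bar_eq]
  module

/-- `E(u, v) = E(v, -lam u)`: up to the symmetry, the two vectors play the same role. -/
theorem eichler_swap {u v : Idx n → R} (hu : form H u u = 0) (hv : form H v v = 0)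
    (huv : form H u v = 0) : eichler H u v 0 = eichler H v (-H.lam • u) 0 := by
  apply act_ext
  intro w
  rw [act_eichler _ hu huv, act_eichler _ hv (by
    simp [form_smul_right, form_neg_right, form_eq_zero_symm H huv])]
  simp only [form_smul_left, map_neg]
  have h : H.bar H.lam * H.lam = 1 := H.bar_lam_mul_lam
  have : (H.bar H.lam * form H v w) • -H.lam • u = -(form H v w • u) := by
    rw [smul_smul, ← neg_smul]; congr 1; linear_combination (-form H v w) * h
  rw [this]
  module

end Eichler

/-! ### The elementary matrices as Eichler transformations -/

section Elementary

variable {R : Type*} [CommRing R] {H : HermitianRing R} {n : ℕ}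

theorem preserves_of_mem {Δ : OddFormParameter H} {g : GeneralLinearGroup (Idx n) R}
    (hg : g ∈ unitaryGroup n Δ) : Preserves H g := hg.1

theorem OddFormParameter.central_mem (Δ : OddFormParameter H) (z : R) :
    (⟨0, z - H.bar z * H.lam⟩ : Heisenberg H) ∈ Δ.carrier := Δ.min_le ⟨z, rfl⟩

theorem OddFormParameter.trace_eq (Δ : OddFormParameter H) {p : Heisenberg H}
    (hp : p ∈ Δ.carrier) : H.bar p.fst * H.mu * p.fst + p.snd + H.bar p.snd * H.lam = 0 :=
  Δ.le_max hp

/-- The map `q` is additive up to the form `b` and elements of the smallest form parameter. -/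
theorem quad_add (u v : Idx n → R) :
    quad H (u + v) = quad H u + quad H v + ⟨0, form H u v⟩ +
      ⟨0, ∑ r : Fin n, H.bar (v (some (Sum.inl r))) * u (some (Sum.inr r))
        - H.bar (∑ r : Fin n, H.bar (v (some (Sum.inl r))) * u (some (Sum.inr r))) * H.lam⟩ := by
  ext
  · simp [quad, Heisenberg.add_def]
  · simp only [quad, Heisenberg.add_def, form, Pi.add_apply, map_add, map_sum, map_mul,
      H.bar_bar_eq, add_mul, mul_add, Finset.sum_add_distrib, Finset.sum_mul, map_zero,
      zero_mul]
    have : ∑ r : Fin n, H.bar (u (some (Sum.inr r))) * H.lam * v (some (Sum.inl r))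
        = ∑ r : Fin n, v (some (Sum.inl r)) * H.bar (u (some (Sum.inr r))) * H.lam :=
      Finset.sum_congr rfl fun r _ => by ring
    rw [this]
    ring

theorem quad_smul (c : R) (u : Idx n → R) : quad H (c • u) = (quad H u).circ c := by
  ext
  · simp [quad, Heisenberg.circ, mul_comm]
  · simp only [quad, Heisenberg.circ, Pi.smul_apply, smul_eq_mul, map_mul, Finset.mul_sum,
      Finset.sum_mul]
    exact Finset.sum_congr rfl fun r _ => by ring

/-- A criterion for membership in the unitary group which only involves the displacement
`g u - u`. -/
theorem mem_unitaryGroup_of_displacement (Δ : OddFormParameter H)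
    {g : GeneralLinearGroup (Idx n) R} (hg : Preserves H g)
    (h : ∀ u, quad H (act g u - u) + ⟨0, form H u (act g u - u)⟩ ∈ Δ.carrier) :
    g ∈ unitaryGroup n Δ := by
  refine ⟨hg, fun u => ?_⟩
  obtain ⟨v, hv⟩ : ∃ v, v = act g u - u := ⟨_, rfl⟩
  have hgu : g.1 *ᵥ u = u + v := by rw [hv]; simp [act]
  have hu := h u
  rw [← hv] at hu
  rw [hgu]
  have hz := Δ.carrier.add_mem hu (Δ.central_mem (H.bar (v none) * H.mu * u none
    + ∑ r : Fin n, H.bar (v (some (Sum.inl r))) * u (some (Sum.inr r))))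
  convert hz using 1
  rw [quad_add, sub_eq_add_neg]
  have hmu := H.mu_eq
  ext
  · simp [quad, Heisenberg.add_def, Heisenberg.neg_def]
  · simp only [quad, Heisenberg.add_def, Heisenberg.neg_def, map_add, map_zero, map_mul,
      H.bar_bar_eq]
    linear_combination (-H.bar (u none) * v none) * hmu

theorem single_mulVec_some (k : Hb n) (r : Idx n) (c : R) (w : Idx n → R) :
    Matrix.single (some k) r c *ᵥ w = (c * w r) • ee k := by
  ext s
  simp only [Matrix.mulVec, dotProduct, Matrix.single_apply, ee, Pi.smul_apply, Pi.single_apply,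
    smul_eq_mul]
  by_cases h : s = some k
  · subst h; simp
  · simp [h, Ne.symm h]

theorem single_mulVec_none (r : Idx n) (c : R) (w : Idx n → R) :
    (Matrix.single none r c : Matrix (Idx n) (Idx n) R) *ᵥ w = (c * w r) • e0 := by
  ext s
  simp only [Matrix.mulVec, dotProduct, Matrix.single_apply, e0, Pi.smul_apply, Pi.single_apply,
    smul_eq_mul]
  by_cases h : s = none
  · subst h; simp
  · simp [h, Ne.symm h]

/-- The powers of `lam` in the definitions of the elementary matrices are values of `theta`, up to
the unit `bar lam`. -/
theorem lamPow_extra (k : Hb n) :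
    H.lamPow (-(((eps k : ℤ) + 1) / 2)) = H.bar H.lam * H.theta k := by
  rcases k with k | k
  · simp only [eps, HermitianRing.lamPow, HermitianRing.theta]
    norm_num
    rfl
  · simp only [eps, HermitianRing.lamPow, HermitianRing.theta]
    norm_num
    exact H.bar_lam_mul_lam.symm

theorem lamPow_left (k : Hb n) :
    H.lamPow ((1 - (eps k : ℤ)) / 2) = H.theta k := by
  rcases k with k | k
  · simp [eps, HermitianRing.lamPow, HermitianRing.theta]
  · simp only [eps, HermitianRing.lamPow, HermitianRing.theta]
    norm_num
    rfl

theorem lamPow_right (k : Hb n) :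
    H.lamPow (((eps k : ℤ) - 1) / 2) = H.bar H.lam * H.theta (opp k) := by
  rcases k with k | k
  · simp only [eps, HermitianRing.lamPow, HermitianRing.theta, opp, Sum.swap]
    norm_num
    exact H.bar_lam_mul_lam.symm
  · simp only [eps, HermitianRing.lamPow, HermitianRing.theta, opp, Sum.swap]
    norm_num
    rfl

/-- Short root matrices are Eichler transformations attached to two basis vectors. -/
theorem shortRoot_eq {k l : Hb n} (hkl : k ≠ opp l) (x : R) :
    shortRoot H k (opp l) (x * H.theta l) = (eichler H (x • ee k) (ee l) 0).1 := by
  refine Matrix.ext_of_mulVec_single fun i => ?_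
  set w : Idx n → R := Pi.single i 1
  have h := act_eichler (H := H) (e := x • ee k) (v := ee l) 0
    (by simp [form_smul_left, form_smul_right])
    (by simp [form_smul_left, form_ee_ne H hkl]) w
  rw [act] at h
  rw [h, shortRoot, Matrix.sub_mulVec, Matrix.add_mulVec, Matrix.one_mulVec, single_mulVec_some,
    single_mulVec_some, lamPow_left, lamPow_right]
  simp only [opp_opp, form_smul_left, form_ee_left, map_mul]
  have := H.theta_mul_bar l
  rw [zero_mul, zero_smul, add_zero, smul_smul]
  refine congrArg₂ _ (congrArg₂ _ rfl (congrArg (· • _) ?_)) (congrArg (· • _) ?_)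
  · ring
  · linear_combination (H.bar H.lam * H.bar x * H.theta k * w (some (opp k))) * this

/-- The extra short root element attached to `p` in the form parameter. In contrast to the matrices
`extraShortRoot`, the parametrisation is by the same form parameter for all indices. -/
noncomputable def extra (k : Hb n) (p : Heisenberg H) : GeneralLinearGroup (Idx n) R :=
  eichler H (ee k) (p.fst • e0) (H.bar H.lam * p.snd)

theorem act_extra (k : Hb n) (p : Heisenberg H) (w : Idx n → R) :
    act (extra k p) w = w + (H.bar p.fst * H.mu * w none) • ee k
      - (H.bar H.lam * H.theta k * w (some (opp k)) * p.fst) • e0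
      + (H.bar H.lam * p.snd * H.theta k * w (some (opp k))) • ee k := by
  rw [extra, act_eichler _ (by simp) (by simp [form_smul_right])]
  simp only [form_smul_left, form_ee_left, form_e0_left, smul_smul, mul_assoc]

/-- The normalisation `p ∘ (-lam * bar (theta k))` matches the two parametrisations of extra short
root matrices. -/
theorem extraShortRoot_eq (k : Hb n) (p : Heisenberg H) :
    extraShortRoot H k p.fst (H.bar H.lam * H.theta k * p.snd)
      = (extra k (p.circ (-(H.lam * H.bar (H.theta k))))).1 := by
  refine Matrix.ext_of_mulVec_single fun i => ?_
  set w : Idx n → R := Pi.single i 1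
  have h := act_extra k (p.circ (-(H.lam * H.bar (H.theta k)))) w
  rw [act] at h
  rw [h, extraShortRoot, Matrix.add_mulVec, Matrix.sub_mulVec, Matrix.add_mulVec,
    Matrix.one_mulVec, single_mulVec_some,
    single_mulVec_some, single_mulVec_none, add_comm (1 : ℤ), lamPow_extra]
  simp only [Heisenberg.circ, map_mul, map_neg, H.bar_bar_eq]
  have h1 := H.theta_mul_bar k
  have h2 := H.lam_mul_bar_lam
  have e1 : H.bar H.lam * H.theta k * w (some (opp k)) * (p.fst * -(H.lam * H.bar (H.theta k)))
      = - (p.fst * w (some (opp k))) := by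
    linear_combination (-w (some (opp k)) * p.fst * H.bar H.lam * H.lam) * h1
      - w (some (opp k)) * p.fst * h2
  have e2 : H.bar H.lam * (-(H.bar H.lam * H.theta k) * p.snd * -(H.lam * H.bar (H.theta k)))
      * H.theta k * w (some (opp k)) = H.bar H.lam * H.theta k * p.snd * w (some (opp k)) := by
    linear_combination (H.bar H.lam * H.bar H.lam * H.lam * p.snd * H.theta k
      * w (some (opp k))) * h1 + (H.bar H.lam * p.snd * H.theta k * w (some (opp k))) * h2
  rw [e1, e2]
  module

/-- Membership in `Δ^(-ε(k))` in terms of `Δ`. For `k > 0` this uses that `Δ` is stable under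
`(x, y) ↦ (x, lam * bar y)`, which is `-(x, y) ∘ (-1)` by the trace condition. -/
theorem signed_iff (Δ : OddFormParameter H) (k : Hb n) (p : Heisenberg H) :
    (p.fst, H.bar H.lam * H.theta k * p.snd) ∈ Δ.signed (-eps k) ↔ p ∈ Δ.carrier := by
  rcases k with k | k
  · have key : ∀ p ∈ Δ.carrier, (⟨p.fst, H.lam * H.bar p.snd⟩ : Heisenberg H) ∈ Δ.carrier := by
      intro p hp
      have h := Δ.circ_mem _ (Δ.carrier.neg_mem hp) (-1)
      convert h using 1
      have ht := Δ.trace_eq hp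
      ext
      · simp [Heisenberg.circ, Heisenberg.neg_def]
      · simp [Heisenberg.circ, Heisenberg.neg_def]
        linear_combination ht
    have hne : ¬ ((-1 : ℤˣ) = 1) := by decide
    simp only [OddFormParameter.signed, eps, hne, if_false, Set.mem_ofPred_eq,
      HermitianRing.theta, map_mul, H.bar_bar_eq, mul_one]
    constructor
    · intro h
      have h' := key _ h
      simp only [map_mul, H.bar_bar_eq] at h'
      convert h' using 1
      ext
      · rfl
      · simp only []
        linear_combination (-p.snd) * H.lam_mul_bar_lam
    · exact key p
  · simp only [OddFormParameter.signed, eps, neg_neg, if_true, Set.mem_ofPred_eq,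
      HermitianRing.theta, H.bar_lam_mul_lam, one_mul]

variable (Δ : OddFormParameter H)

theorem elementaryGroup_le : elementaryGroup n Δ ≤ unitaryGroup n Δ := by
  rw [elementaryGroup, Subgroup.closure_le]
  exact fun g hg => hg.1

theorem preserves_of_mem_elementary {Δ : OddFormParameter H} {g : GeneralLinearGroup (Idx n) R}
    (hg : g ∈ elementaryGroup n Δ) : Preserves H g :=
  preserves_of_mem (elementaryGroup_le Δ hg)

theorem preserves_eichler {u v : Idx n → R} (hu : form H u u = 0) (hv : form H v v = 0)
    (huv : form H u v = 0) : Preserves H (eichler H u v 0) := by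
  intro w w'
  rw [act_eichler _ hu huv, act_eichler _ hu huv]
  have hvu := form_eq_zero_symm H huv
  simp only [form_add_left, form_add_right, form_sub_left, form_sub_right, form_smul_left,
    form_smul_right, hu, hv, huv, hvu, zero_mul, zero_smul, add_zero, map_mul, H.bar_bar_eq]
  rw [form_symm H u w, form_symm H v w]
  linear_combination -H.bar (form H v w) * form H u w' * H.lam_mul_bar_lam

theorem preserves_extra {p : Heisenberg H} (hp : p ∈ Δ.carrier) (k : Hb n) :
    Preserves H (extra k p) := by
  intro w w'
  have ht := Δ.trace_eq hp
  have h1 := H.lam_mul_bar_lam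
  rw [extra, act_eichler _ (by simp) (by simp [form_smul_right]),
    act_eichler _ (by simp) (by simp [form_smul_right])]
  simp only [form_add_left, form_add_right, form_sub_left, form_sub_right, form_smul_left,
    form_smul_right, map_mul, H.bar_bar_eq,
    form_ee_self, form_ee_e0, form_e0_ee, form_e0_e0]
  rw [form_symm H (ee k) w, form_symm H e0 w]
  set A := form H (ee k) w
  set A' := form H (ee k) w'
  set B := form H e0 w
  linear_combination (H.bar A * A') * ht
    + (H.bar A * A' * (p.snd + H.bar p.fst * H.mu * p.fst) - p.fst * H.bar B * A') * h1

theorem eichler_short_mem {k l : Hb n} (hkl : k ≠ l) (hkl' : k ≠ opp l) (x y : R) :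
    eichler H (x • ee k) (y • ee l) 0 ∈ elementaryGroup n Δ := by
  have key : ∀ x : R, eichler H (x • ee k) (ee l) 0 ∈ elementaryGroup n Δ := by
    intro x
    apply Subgroup.subset_closure
    refine ⟨mem_unitaryGroup_of_displacement Δ (preserves_eichler ?_ ?_ ?_) ?_,
      Or.inl ⟨k, opp l, x * H.theta l, hkl', by simpa using hkl, (shortRoot_eq hkl' x).symm⟩⟩
    · simp [form_smul_left, form_smul_right]
    · simp
    · simp [form_smul_left, form_ee_ne H hkl']
    · intro u
      rw [act_eichler _ (by simp [form_smul_left, form_smul_right])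
        (by simp [form_smul_left, form_ee_ne H hkl'])]
      have hv : u + form H (ee l) u • x • ee k - (H.bar H.lam * form H (x • ee k) u) • ee l
          + ((0 : R) * form H (x • ee k) u) • x • ee k - u
          = (form H (ee l) u * x) • ee k - (H.bar H.lam * H.bar x * form H (ee k) u) • ee l := by
        simp only [form_smul_left]
        module
      rw [hv]
      have hz := Δ.central_mem (form H u (ee k) * x * form H (ee l) u)
      convert hz using 1
      have hs : ∀ c d : R, (quad H (c • ee k - d • ee l : Idx n → R)).snd = 0 := by
        intro c d
        simp only [quad, Pi.sub_apply, Pi.smul_apply, smul_eq_mul]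
        refine Finset.sum_eq_zero fun r _ => ?_
        rcases k with k | k <;> rcases l with l | l <;>
          simp [ee, opp, Pi.single_apply] at hkl hkl' ⊢
        · intro h1; rw [if_neg (by rw [h1]; exact fun h => hkl' h.symm)]; simp
        · intro h1; rw [if_neg (by rw [h1]; exact hkl')]; simp
      ext
      · simp [quad, Heisenberg.add_def]
      · simp only [Heisenberg.add_def, hs]
        simp only [quad, Pi.sub_apply, Pi.smul_apply, ee_none, form_sub_right, form_smul_right]
        rw [form_symm H (ee k) u, form_symm H (ee l) u]
        simp only [map_mul, H.bar_bar_eq, smul_eq_mul, mul_zero, sub_zero, zero_add]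
        ring
  have h := key (H.bar y * x)
  rw [mul_smul, eichler_smul_left, H.bar_bar_eq] at h
  · exact h
  · simp [form_smul_left, form_smul_right]
  · simp [form_smul_left, form_ee_ne H hkl']

theorem extra_mem {p : Heisenberg H} (hp : p ∈ Δ.carrier) (k : Hb n) :
    extra k p ∈ elementaryGroup n Δ := by
  apply Subgroup.subset_closure
  constructor
  · refine mem_unitaryGroup_of_displacement Δ (preserves_extra Δ hp k) fun u => ?_
    set β := form H (ee k) u with hβ
    have h1 := Δ.carrier.add_mem (Δ.circ_mem p hp (-(H.bar H.lam * β)))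
      (Δ.central_mem (H.lam * H.bar β * H.bar p.fst * H.mu * u none))
    have hd : act (extra k p) u - u = (-(H.bar H.lam * β * p.fst)) • e0
        + (H.bar p.fst * H.mu * u none + H.bar H.lam * p.snd * β) • ee k := by
      rw [act_extra, hβ, form_ee_left]
      module
    rw [hd]
    convert h1 using 1
    have hs : ∀ c d : R, (quad H (c • e0 + d • ee k : Idx n → R)).snd = 0 := by
      intro c d
      simp only [quad, Pi.add_apply, Pi.smul_apply, smul_eq_mul]
      refine Finset.sum_eq_zero fun r _ => ?_
      rcases k with k | k <;> simp [ee, Pi.single_apply]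
    have h2 := H.lam_mul_bar_lam
    have h3 := H.bar_mu
    ext
    · simp only [Heisenberg.add_def, Heisenberg.circ, quad, Pi.add_apply, Pi.smul_apply, e0_none,
        ee_none, smul_eq_mul]
      ring
    · simp only [Heisenberg.add_def, hs]
      simp only [Heisenberg.circ, form_add_right, form_smul_right, form_e0_right]
      rw [form_symm H (ee k) u, ← hβ]
      simp only [quad, Pi.add_apply, Pi.smul_apply, e0_none,
        ee_none, smul_eq_mul, map_mul, map_neg, H.bar_bar_eq, h3]
      linear_combination (H.bar H.lam * β * p.fst * H.bar (u none) * H.mu) * h2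
  · obtain ⟨p', hp'⟩ : ∃ p', p' = p.circ (-(H.bar H.lam * H.theta k)) := ⟨_, rfl⟩
    refine Or.inr ⟨k, p'.fst, H.bar H.lam * H.theta k * p'.snd,
      (signed_iff Δ k p').2 (hp' ▸ Δ.circ_mem p hp _), ?_⟩
    rw [extraShortRoot_eq, hp']
    congr 2
    have h1 := H.theta_mul_bar k
    have h2 := H.lam_mul_bar_lam
    ext
    · simp only [Heisenberg.circ]
      linear_combination (-p.fst * H.lam * H.bar H.lam) * h1 - p.fst * h2
    · simp only [Heisenberg.circ, map_mul, map_neg, H.bar_bar_eq]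
      linear_combination (-p.snd * (H.lam * H.bar H.lam) ^ 2 * (H.theta k * H.bar (H.theta k) + 1))
        * h1 - p.snd * (H.lam * H.bar H.lam + 1) * h2

end Elementary

/-! ### Products of elementary conjugates -/

section Products

variable {R : Type*} [CommRing R] {H : HermitianRing R} {n : ℕ}

/-- `g` is a product of an even number, at most `N`, of elementary unitary `σ`-conjugates.
Allowing fewer factors is harmless since `σ * σ⁻¹` can be used for padding, see
`ProdConj.isProductOfConjugates`. -/
def ProdConj (Δ : OddFormParameter H) (σ : GeneralLinearGroup (Idx n) R) (N : ℕ)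
    (g : GeneralLinearGroup (Idx n) R) : Prop :=
  ∃ L : List (GeneralLinearGroup (Idx n) R),
    L.length ≤ N ∧ Even L.length ∧ (∀ τ ∈ L, IsElementaryConjugate Δ σ τ) ∧ L.prod = g

variable {Δ : OddFormParameter H} {σ : GeneralLinearGroup (Idx n) R} {N M : ℕ}
  {g h x : GeneralLinearGroup (Idx n) R}

theorem IsElementaryConjugate.inv (hg : IsElementaryConjugate Δ σ g) :
    IsElementaryConjugate Δ σ g⁻¹ := by
  obtain ⟨x, hx, rfl | rfl⟩ := hg
  · exact ⟨x, hx, Or.inr (by group)⟩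
  · exact ⟨x, hx, Or.inl (by group)⟩

theorem IsElementaryConjugate.conj (hg : IsElementaryConjugate Δ σ g)
    (hx : x ∈ elementaryGroup n Δ) : IsElementaryConjugate Δ σ (x * g * x⁻¹) := by
  obtain ⟨y, hy, rfl | rfl⟩ := hg
  · exact ⟨x * y, mul_mem hx hy, Or.inl (by group)⟩
  · exact ⟨x * y, mul_mem hx hy, Or.inr (by group)⟩

namespace ProdConj

theorem mono (hg : ProdConj Δ σ N g) (hNM : N ≤ M) : ProdConj Δ σ M g := by
  obtain ⟨L, h1, h2⟩ := hg
  exact ⟨L, h1.trans hNM, h2⟩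

theorem one : ProdConj Δ σ 0 1 := ⟨[], by simp⟩

theorem mul (hg : ProdConj Δ σ N g) (hh : ProdConj Δ σ M h) : ProdConj Δ σ (N + M) (g * h) := by
  obtain ⟨L, h1, h2, h3, rfl⟩ := hg
  obtain ⟨L', h1', h2', h3', rfl⟩ := hh
  refine ⟨L ++ L', by simp; omega, by simpa using h2.add h2', fun τ hτ => ?_, by simp⟩
  rcases List.mem_append.1 hτ with hτ | hτ
  · exact h3 τ hτ
  · exact h3' τ hτ

theorem inv (hg : ProdConj Δ σ N g) : ProdConj Δ σ N g⁻¹ := by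
  obtain ⟨L, h1, h2, h3, rfl⟩ := hg
  refine ⟨(L.map (·⁻¹)).reverse, by simpa, by simpa, fun τ hτ => ?_, by
    rw [List.prod_inv_reverse]⟩
  simp only [List.mem_reverse, List.mem_map] at hτ
  obtain ⟨ρ, hρ, rfl⟩ := hτ
  exact (h3 ρ hρ).inv

theorem conj (hg : ProdConj Δ σ N g) (hx : x ∈ elementaryGroup n Δ) :
    ProdConj Δ σ N (x * g * x⁻¹) := by
  obtain ⟨L, h1, h2, h3, rfl⟩ := hg
  refine ⟨L.map (fun τ => x * τ * x⁻¹), by simpa, by simpa, fun τ hτ => ?_, ?_⟩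
  · simp only [List.mem_map] at hτ
    obtain ⟨ρ, hρ, rfl⟩ := hτ
    exact (h3 ρ hρ).conj hx
  · exact (map_list_prod (MulAut.conj x) L).symm

theorem conj_inv (hg : ProdConj Δ σ N g) (hx : x ∈ elementaryGroup n Δ) :
    ProdConj Δ σ N (x⁻¹ * g * x) := by
  simpa using hg.conj (inv_mem hx)

theorem commutator (hg : ProdConj Δ σ N g) (hx : x ∈ elementaryGroup n Δ) :
    ProdConj Δ σ (2 * N) (g * x * g⁻¹ * x⁻¹) := by
  rw [two_mul, mul_assoc, mul_assoc, ← mul_assoc x]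
  exact hg.mul (hg.inv.conj hx)

theorem cast_eq (hg : ProdConj Δ σ N g) (hgh : h = g) : ProdConj Δ σ N h := hgh ▸ hg

/-- Two conjugates of `σ` and of `σ⁻¹`. -/
theorem pair (hg : g ∈ elementaryGroup n Δ) (hh : h ∈ elementaryGroup n Δ) :
    ProdConj Δ σ 2 (g * σ * g⁻¹ * (h * σ⁻¹ * h⁻¹)) :=
  ⟨[g * σ * g⁻¹, h * σ⁻¹ * h⁻¹], by simp, by simp, by
    simp only [List.mem_cons, List.not_mem_nil, or_false, forall_eq_or_imp, forall_eq]
    exact ⟨⟨g, hg, Or.inl rfl⟩, ⟨h, hh, Or.inr rfl⟩⟩, by simp⟩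

theorem pair_inv {g h : GeneralLinearGroup (Idx n) R} (hg : g ∈ elementaryGroup n Δ)
    (hh : h ∈ elementaryGroup n Δ) :
    ProdConj Δ σ 2 (g * σ⁻¹ * g⁻¹ * (h * σ * h⁻¹)) :=
  ⟨[g * σ⁻¹ * g⁻¹, h * σ * h⁻¹], by simp, by simp, by
    simp only [List.mem_cons, List.not_mem_nil, or_false, forall_eq_or_imp, forall_eq]
    exact ⟨⟨g, hg, Or.inr rfl⟩, ⟨h, hh, Or.inl rfl⟩⟩, by simp⟩

/-- If `ω` is a product of two conjugates of `σ` or its inverse, then every conjugate of `ω` counts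
as two conjugates of `σ`. -/
theorem trans {ω : GeneralLinearGroup (Idx n) R} (hg : ProdConj Δ ω N g)
    (hω : ProdConj Δ σ 2 ω) : ProdConj Δ σ (2 * N) g := by
  obtain ⟨L, h1, h2, h3, rfl⟩ := hg
  have key : ProdConj Δ σ (2 * L.length) L.prod := by
    clear h1 h2
    induction L with
    | nil => simpa using one
    | cons τ L ih =>
      rw [List.prod_cons, List.length_cons, mul_add, mul_one, add_comm]
      refine mul ?_ (ih fun ρ hρ => h3 ρ (List.mem_cons_of_mem _ hρ))
      obtain ⟨x, hx, rfl | rfl⟩ := h3 τ List.mem_cons_self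
      · exact hω.conj hx
      · exact hω.inv.conj hx
  exact key.mono (by omega)

/-- A conjugate of `σ` by an elementary matrix has the same elementary conjugates as `σ`. -/
theorem of_conj (hx : x ∈ elementaryGroup n Δ) (hg : ProdConj Δ (x * σ * x⁻¹) N g) :
    ProdConj Δ σ N g := by
  obtain ⟨L, a1, a2, a3, a4⟩ := hg
  refine ⟨L, a1, a2, fun τ hτ => ?_, a4⟩
  obtain ⟨y, hy, rfl | rfl⟩ := a3 τ hτ
  · exact ⟨y * x, mul_mem hy hx, Or.inl (by group)⟩
  · exact ⟨y * x, mul_mem hy hx, Or.inr (by group)⟩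

/-- Pairs `σ * σ⁻¹` fill up the product to the exact number of factors. -/
theorem isProductOfConjugates (hg : ProdConj Δ σ N g) (hN : Even N) :
    IsProductOfConjugates Δ σ N g.1 := by
  obtain ⟨L, h1, h2, h3, rfl⟩ := hg
  obtain ⟨m, hm⟩ : ∃ m, N = L.length + 2 * m := by
    obtain ⟨a, ha⟩ := hN
    obtain ⟨c, hc⟩ := h2
    exact ⟨a - c, by omega⟩
  refine ⟨L ++ (List.replicate m [σ, σ⁻¹]).flatten, ?_, fun τ hτ => ?_, ?_⟩
  · simp [hm, mul_comm]
  · rcases List.mem_append.1 hτ with hτ | hτ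
    · exact h3 τ hτ
    · rw [List.mem_flatten] at hτ
      obtain ⟨l, hl, hτ⟩ := hτ
      rw [List.eq_of_mem_replicate hl] at hτ
      simp only [List.mem_cons, List.not_mem_nil, or_false] at hτ
      rcases hτ with rfl | rfl
      · exact ⟨1, one_mem _, Or.inl (by simp)⟩
      · exact ⟨1, one_mem _, Or.inr (by simp)⟩
  · simp [List.prod_flatten]

end ProdConj

end Products

/-! ### Parameters of short root elements -/

section Roots

variable {R : Type*} [CommRing R] {H : HermitianRing R} {n : ℕ}

theorem form_smul_ee_self (x : R) (k : Hb n) : form H (x • ee k) (x • ee k) = 0 := by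
  simp [form_smul_left, form_smul_right]

theorem form_smul_ee {k l : Hb n} (h : k ≠ opp l) (x y : R) :
    form H (x • ee k) (y • ee l) = 0 := by
  simp [form_smul_left, form_smul_right, form_ee_ne H h]

theorem form_smul_ee_right {k l : Hb n} (h : k ≠ opp l) (x : R) :
    form H (x • ee k) (ee l) = 0 := by
  simp [form_smul_left, form_ee_ne H h]

theorem act_short {k l : Hb n} (hkl : k ≠ opp l) (x : R) (w : Idx n → R) :
    act (eichler H (x • ee k) (ee l) 0) w = w + (H.theta l * w (some (opp l)) * x) • ee k
      - (H.bar H.lam * H.bar x * H.theta k * w (some (opp k))) • ee l := by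
  rw [act_eichler _ (form_smul_ee_self x k) (form_smul_ee_right hkl x)]
  simp only [form_smul_left, form_ee_left]
  module

theorem eichler_add_left {e e' v : Idx n → R} (he : form H e e = 0) (he' : form H e' e' = 0)
    (hee' : form H e e' = 0) (hev : form H e v = 0) (hev' : form H e' v = 0)
    (hv : form H v v = 0) :
    eichler H (e + e') v 0 = eichler H e v 0 * eichler H e' v 0 := by
  have h1 := form_eq_zero_symm H hee'
  have h2 := form_eq_zero_symm H hev
  have h3 := form_eq_zero_symm H hev'
  apply act_ext
  intro w
  rw [act_mul, act_eichler _ he' hev', act_eichler _ he hev, act_eichler _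
    (by simp [form_add_left, form_add_right, *]) (by simp [form_add_left, *])]
  simp only [form_add_left, form_add_right, form_sub_right, form_smul_right, *]
  module

theorem short_add {k l : Hb n} (hkl : k ≠ opp l) (x y : R) :
    eichler H ((x + y) • ee k) (ee l) 0
      = eichler H (x • ee k) (ee l) 0 * eichler H (y • ee k) (ee l) 0 := by
  have h : ∀ x : R, form H (x • ee k) (ee l) = 0 := form_smul_ee_right hkl
  rw [add_smul, eichler_add_left (form_smul_ee_self _ _) (form_smul_ee_self _ _)
    (form_smul_ee (opp_ne_self k).symm x y) (h x) (h y) (form_ee_self H l)]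

/-- Transpositions of basis vectors, up to sign, are realised by elementary matrices. -/
theorem exists_weyl (Δ : OddFormParameter H) {k k' : Hb n} (h : k ≠ k') (h' : k ≠ opp k') :
    ∃ w ∈ elementaryGroup n Δ, act w (ee k) = ee k' ∧ act w e0 = e0 ∧
      ∀ l, l ≠ k → l ≠ k' → l ≠ opp k → l ≠ opp k' → act w (ee l) = ee l := by
  have hk' : k' ≠ opp k := fun h'' => h' (by rw [h'', opp_opp])
  have hk : opp k' ≠ k := h'.symm
  replace h' : k ≠ k' ∧ k' ≠ k := ⟨h, h.symm⟩
  have a1 := H.theta_mul_bar (opp k)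
  have a2 := H.theta_mul_bar (opp k')
  refine ⟨eichler H (-H.bar (H.theta (opp k')) • ee k) (ee (opp k')) 0
    * eichler H (H.bar (H.theta (opp k)) • ee k') (ee (opp k)) 0, mul_mem ?_ ?_, ?_, ?_, ?_⟩
  · simpa using eichler_short_mem Δ hk.symm (by simpa using h) (-H.bar (H.theta (opp k'))) 1
  · simpa using eichler_short_mem Δ hk' (by simpa using h.symm) (H.bar (H.theta (opp k))) 1
  · rw [act_mul, act_short (by simpa using h'.1), act_short (by simpa using h'.2)]
    simp only [opp_opp, ee_self, ee_ne (opp_ne_self k), ee_ne hk'.symm, mul_one, mul_zero,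
      sub_zero, zero_smul, a1, one_smul, Pi.add_apply, ee_ne h.symm, ee_ne hk,
      add_zero, zero_add, mul_neg, a2, neg_smul]
    abel
  · rw [act_mul, act_short (by simpa using h'.1), act_short (by simpa using h'.2)]
    simp
  · intro l h1 h2 h3 h4
    have h5 : opp k ≠ l := h3.symm
    have h6 : opp k' ≠ l := h4.symm
    rw [act_mul, act_short (by simpa using h'.1), act_short (by simpa using h'.2)]
    simp [ee_ne h1.symm, ee_ne h2.symm, ee_ne h5, ee_ne h6]

theorem exists_third (hn : 3 ≤ n) (k l : Hb n) :
    ∃ r : Hb n, r ≠ k ∧ r ≠ opp k ∧ r ≠ l ∧ r ≠ opp l := by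
  have : ∃ r : Fin n, r ∉ ({Sum.elim id id k, Sum.elim id id l} : Finset (Fin n)) := by
    by_contra! hr
    have h1 : (Finset.univ : Finset (Fin n)) ⊆ {Sum.elim id id k, Sum.elim id id l} :=
      fun r _ => hr r
    have h2 := (Finset.card_le_card h1).trans Finset.card_le_two
    simp at h2
    omega
  obtain ⟨r, hr⟩ := this
  refine ⟨Sum.inl r, ?_⟩
  rcases k with k | k <;> rcases l with l | l <;> simpa [opp] using hr

theorem extra_mul (k : Hb n) (p p' : Heisenberg H) :
    extra k p * extra k p' = extra k (p + p') := by
  rw [extra, extra, extra, eichler_mul _ _ (form_ee_self H k) (by simp [form_smul_right])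
    (by simp [form_smul_right]), Heisenberg.add_def, add_smul]
  congr 1
  simp only [form_smul_left, form_smul_right, form_e0_e0]
  ring

theorem extra_zero (k : Hb n) : extra k (0 : Heisenberg H) = 1 := by
  have h := extra_mul k (0 : Heisenberg H) 0
  rw [add_zero] at h
  exact mul_eq_left.1 h

theorem extra_conj {g : GeneralLinearGroup (Idx n) R} (hg : Preserves H g) {k k' : Hb n}
    (hk : act g (ee k) = ee k') (h0 : act g e0 = e0) (p : Heisenberg H) :
    g * extra k p * g⁻¹ = extra k' p := by
  rw [extra, eichler_conj hg, hk, act_smul, h0, extra]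

variable {Δ : OddFormParameter H} {σ : GeneralLinearGroup (Idx n) R} {N M : ℕ}

/-- The extra short roots are permuted transitively by the elementary group, so the index of an
extra short root element can be changed. -/
theorem ProdConj.extra_any (hn : 3 ≤ n) {k : Hb n} {p : Heisenberg H}
    (h : ProdConj Δ σ N (extra k p)) (k' : Hb n) : ProdConj Δ σ N (extra k' p) := by
  have key : ∀ k k' : Hb n, k ≠ k' → k ≠ opp k' → ProdConj Δ σ N (extra k p) →
      ProdConj Δ σ N (extra k' p) := by
    intro k k' h1 h2 h
    obtain ⟨w, hw, hk, h0, -⟩ := exists_weyl Δ h1 h2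
    rw [← extra_conj (preserves_of_mem_elementary hw) hk h0]
    exact h.conj hw
  obtain ⟨r, hr1, hr2, hr3, hr4⟩ := exists_third hn k k'
  exact key r k' hr3 hr4 (key k r hr1.symm (fun e => hr2 (by rw [e, opp_opp])) h)

variable (Δ σ N) in
/-- All short root elements with parameters in the ideal generated by `z` are products of at most
`N` elementary unitary `σ`-conjugates. -/
def ShortBound (z : R) : Prop :=
  ∀ k l : Hb n, k ≠ l → k ≠ opp l → ∀ y : R,
    ProdConj Δ σ N (eichler H ((y * z) • ee k) (ee l) 0)

/-- It suffices to bound the short root elements for one root, as the Weyl group acts transitively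
on the short roots. -/
theorem shortBound_of_pair (hn : 3 ≤ n) {k l : Hb n} {z : R} (hkl : k ≠ l) (hkl' : k ≠ opp l)
    (h : ∀ y : R, ProdConj Δ σ N (eichler H ((y * z) • ee k) (ee l) 0)) :
    ShortBound Δ σ N z := by
  intro k' l' h1 h1' y
  replace h := h y
  revert h
  generalize y * z = x
  have left₀ : ∀ k k' l : Hb n, k ≠ k' → k ≠ opp k' → k ≠ l → k ≠ opp l → k' ≠ l → k' ≠ opp l →
      ProdConj Δ σ N (eichler H (x • ee k) (ee l) 0) →
      ProdConj Δ σ N (eichler H (x • ee k') (ee l) 0) := by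
    intro k k' l a1 a2 a3 a4 a5 a6 h
    obtain ⟨w, hw, hk, -, hl⟩ := exists_weyl Δ a1 a2
    have hl' := hl l a3.symm a5.symm (fun e => a4 (by rw [e, opp_opp]))
      (fun e => a6 (by rw [e, opp_opp]))
    have := h.conj hw
    rwa [eichler_conj (preserves_of_mem_elementary hw), act_smul, hk, hl'] at this
  have right₀ : ∀ k l l' : Hb n, l ≠ l' → l ≠ opp l' → k ≠ l → k ≠ opp l → k ≠ l' → k ≠ opp l' →
      ProdConj Δ σ N (eichler H (x • ee k) (ee l) 0) →
      ProdConj Δ σ N (eichler H (x • ee k) (ee l') 0) := by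
    intro k l l' a1 a2 a3 a4 a5 a6 h
    obtain ⟨w, hw, hl, -, hk⟩ := exists_weyl Δ a1 a2
    have hk' := hk k a3 a5 a4 a6
    have := h.conj hw
    rwa [eichler_conj (preserves_of_mem_elementary hw), act_smul, hk', hl] at this
  have opp_ne : ∀ {a c : Hb n}, a ≠ opp c → c ≠ opp a := fun h e => h (by rw [e, opp_opp])
  have left : ∀ k k' l : Hb n, k ≠ l → k ≠ opp l → k' ≠ l → k' ≠ opp l →
      ProdConj Δ σ N (eichler H (x • ee k) (ee l) 0) →
      ProdConj Δ σ N (eichler H (x • ee k') (ee l) 0) := by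
    intro k k' l a3 a4 a5 a6 h
    by_cases a1 : k = k'
    · rwa [← a1]
    by_cases a2 : k = opp k'
    · obtain ⟨r, b1, b2, b3, b4⟩ := exists_third hn k l
      exact left₀ r k' l (fun e => b2 (by rw [a2, e, opp_opp])) (fun e => b1 (by rw [a2, e]))
        b3 b4 a5 a6 (left₀ k r l b1.symm (opp_ne b2) a3 a4 b3 b4 h)
    · exact left₀ k k' l a1 a2 a3 a4 a5 a6 h
  have right : ∀ k l l' : Hb n, k ≠ l → k ≠ opp l → k ≠ l' → k ≠ opp l' →
      ProdConj Δ σ N (eichler H (x • ee k) (ee l) 0) →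
      ProdConj Δ σ N (eichler H (x • ee k) (ee l') 0) := by
    intro k l l' a3 a4 a5 a6 h
    by_cases a1 : l = l'
    · rwa [← a1]
    by_cases a2 : l = opp l'
    · obtain ⟨r, b1, b2, b3, b4⟩ := exists_third hn k l
      exact right₀ k r l' (fun e => b4 (by rw [a2, e, opp_opp])) (fun e => b3 (by rw [a2, e]))
        b1.symm (opp_ne b2) a5 a6 (right₀ k l r b3.symm (opp_ne b4) a3 a4 b1.symm (opp_ne b2) h)
    · exact right₀ k l l' a1 a2 a3 a4 a5 a6 h
  intro h
  obtain ⟨r, b1, b2, b3, b4⟩ := exists_third hn k k'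
  exact right k' r l' b3.symm (opp_ne b4) h1 h1'
    (left k k' r b1.symm (opp_ne b2) b3.symm (opp_ne b4)
      (right k l r hkl hkl' b1.symm (opp_ne b2) h))

namespace ShortBound

variable {z z' : R}

theorem mono (h : ShortBound Δ σ N z) (hNM : N ≤ M) : ShortBound Δ σ M z :=
  fun k l h1 h2 y => (h k l h1 h2 y).mono hNM

theorem of_eq_mul (h : ShortBound Δ σ N z) (c : R) (hz : z' = c * z) : ShortBound Δ σ N z' := by
  intro k l h1 h2 y
  rw [hz, ← mul_assoc]
  exact h k l h1 h2 (y * c)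

theorem mul {z : R} (h : ShortBound Δ σ N z) (c : R) : ShortBound Δ σ N (c * z) :=
  h.of_eq_mul c rfl

theorem zero : ShortBound Δ σ 0 (0 : R) := by
  intro k l h1 h2 y
  have h : eichler H ((0 : R) • ee k) (ee l) 0 = 1 := by
    have := short_add (H := H) h2 0 0
    rw [add_zero] at this
    exact mul_eq_left.1 this.symm
  rw [mul_zero, h]
  exact ProdConj.one

theorem add (h : ShortBound Δ σ N z) (h' : ShortBound Δ σ M z') :
    ShortBound Δ σ (N + M) (z + z') := by
  intro k l h1 h2 y
  rw [mul_add, short_add h2]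
  exact (h k l h1 h2 y).mul (h' k l h1 h2 y)

theorem sum {ι : Type*} (s : Finset ι) (N : ι → ℕ) (z : ι → R)
    (h : ∀ i ∈ s, ShortBound Δ σ (N i) (z i)) :
    ShortBound Δ σ (∑ i ∈ s, N i) (∑ i ∈ s, z i) := by
  classical
  induction s using Finset.induction_on with
  | empty => simpa using zero
  | insert i s hi ih =>
    rw [Finset.sum_insert hi, Finset.sum_insert hi]
    exact (h i (Finset.mem_insert_self i s)).add
      (ih fun j hj => h j (Finset.mem_insert_of_mem hj))

theorem bar (h : ShortBound Δ σ N z) : ShortBound Δ σ N (H.bar z) := by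
  intro k l h1 h2 y
  have hlk : l ≠ opp k := fun e => h2 (by rw [e, opp_opp])
  have h3 := h l k h1.symm hlk (-H.bar H.lam * H.bar y)
  rw [eichler_smul_left _ (form_ee_self H l) (form_ee_ne H hlk)] at h3
  rw [eichler_swap (form_smul_ee_self _ k) (form_ee_self H l)
    (form_smul_ee_right h2 _)]
  refine h3.cast_eq ?_
  rw [smul_smul]
  congr 2
  simp [mul_assoc]

theorem trans {ω : GeneralLinearGroup (Idx n) R} (h : ShortBound Δ ω N z)
    (hω : ProdConj Δ σ 2 ω) : ShortBound Δ σ (2 * N) z :=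
  fun k l h1 h2 y => (h k l h1 h2 y).trans hω

theorem of_conj {g : GeneralLinearGroup (Idx n) R} (hg : g ∈ elementaryGroup n Δ)
    (h : ShortBound Δ (g * σ * g⁻¹) N z) : ShortBound Δ σ N z :=
  fun k l h1 h2 y => (h k l h1 h2 y).of_conj hg

/-- Long root elements are commutators of short root elements. -/
theorem extra_central (hn : 3 ≤ n) (h : ShortBound Δ σ N z) (k : Hb n) :
    ProdConj Δ σ (2 * N) (extra k (⟨0, z - H.bar z * H.lam⟩ : Heisenberg H)) := by
  obtain ⟨l, h1, h2, -⟩ := exists_third hn k k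
  have hkl : k ≠ opp l := fun e => h2 (by rw [e, opp_opp])
  have hx := eichler_short_mem Δ hkl (by simpa using h1.symm) (-H.bar (H.theta (opp l))) 1
  rw [one_smul] at hx
  have h3 := ((h.bar k l h1.symm hkl 1).conj hx).mul (h.bar k l h1.symm hkl 1).inv
  rw [eichler_conj (preserves_of_mem_elementary hx), act_smul, act_short (by simpa using h1.symm),
    act_short (by simpa using h1.symm), ← two_mul] at h3
  refine h3.cast_eq ?_
  simp only [opp_opp, ee_self, ee_ne h1, ee_ne (opp_ne_self k), ee_ne h2.symm,
    mul_zero, zero_mul, zero_smul, sub_zero, add_zero, mul_one, one_mul]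
  have h4 := H.theta_mul_bar (opp l)
  have h5 : form H (ee k) (ee l + (H.theta (opp l) * -H.bar (H.theta (opp l))) • ee k) = 0 := by
    simp [form_add_right, form_smul_right, form_neg_right, form_ee_ne H hkl]
  rw [eichler_smul_left _ (form_ee_self H k) h5,
    eichler_smul_left _ (form_ee_self H k) (form_ee_ne H hkl),
    eichler_inv _ (form_ee_self H k) (by simp [form_smul_right, form_ee_ne H hkl]),
    eichler_mul _ _ (form_ee_self H k) (by rw [form_smul_right, h5, mul_zero])
      (by simp [form_neg_right, form_smul_right, form_ee_ne H hkl])]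
  rw [H.bar_bar_eq]
  have h6 : z • (ee l + (H.theta (opp l) * -H.bar (H.theta (opp l))) • ee k) + -(z • ee l)
      = (-z) • (ee k : Idx n → R) := by
    rw [mul_neg, h4]; module
  rw [h6]
  apply act_ext
  intro w
  rw [act_extra, act_eichler _ (form_ee_self H k) (by simp [form_smul_right, form_neg_right])]
  simp only [form_smul_left, form_smul_right, form_neg_right, form_add_left, form_ee_ne H hkl,
    form_ee_left, map_neg, map_zero]
  have h7 := H.lam_mul_bar_lam
  simp only [ee_ne (opp_ne_self l), mul_zero, zero_mul, add_zero, sub_zero, neg_zero, zero_smul]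
  linear_combination (norm := module)
    (-H.bar z * H.theta k * w (some (opp k)) * h7) • (ee k : Idx n → R)

/-- The extra short root element with parameter `p ∘ z` is, up to a short root element, the
commutator of a short root element with parameter `bar z` and the extra short root element with
parameter `p`. -/
theorem extra_circ (hn : 3 ≤ n) (h : ShortBound Δ σ N z) {p : Heisenberg H}
    (hp : p ∈ Δ.carrier) (h' : ShortBound Δ σ M (H.bar z * p.snd)) (k : Hb n) :
    ProdConj Δ σ (2 * N + M) (extra k (p.circ z)) := by
  obtain ⟨l, h1, h2, -⟩ := exists_third hn k k
  have hkl : k ≠ opp l := fun e => h2 (by rw [e, opp_opp])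
  have hlk : l ≠ opp k := h2
  set x := eichler H ((H.bar (H.theta (opp l)) * H.bar z) • ee k) (ee (opp l)) 0 with hx
  have hxP : ProdConj Δ σ N x := h.bar k (opp l) hkl (by simpa using h1.symm) _
  have hyP := h' k l h1.symm hkl (H.bar H.lam)
  have hxU : Preserves H x := preserves_eichler (form_smul_ee_self _ k) (form_ee_self H _)
    (form_smul_ee_right (by simpa using h1.symm) _)
  have hW := extra_mem Δ hp l
  have key : x * extra l p * x⁻¹ = extra l p * extra k (p.circ z)
      * eichler H ((H.bar H.lam * (H.bar z * p.snd)) • ee k) (ee l) 0 := by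
    rw [extra, eichler_conj hxU]
    have e1 : act x (ee l) = ee l + H.bar z • ee k := by
      rw [hx, act_short (by simpa using h1.symm)]
      simp only [opp_opp, ee_self, ee_ne h2.symm, mul_zero, zero_smul, sub_zero, mul_one]
      rw [← mul_assoc, H.theta_mul_bar, one_mul]
    have e2 : act x e0 = e0 := by
      rw [hx, act_short (by simpa using h1.symm)]
      simp
    rw [e1, act_smul, e2]
    apply act_ext
    intro w
    rw [act_mul, act_mul, extra, act_eichler _ (form_ee_self H l) (by simp [form_smul_right]),
      act_eichler _ (form_ee_self H k) (by simp [form_smul_right]),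
      act_eichler _ (form_smul_ee_self _ k)
        (form_smul_ee_right hkl _),
      act_eichler _ (by simp [form_add_left, form_add_right, form_smul_left, form_smul_right,
        form_ee_ne H hkl, form_ee_ne H hlk])
        (by simp [form_add_left, form_smul_left, form_smul_right])]
    simp only [form_add_left, form_add_right, form_sub_right, form_smul_left, form_smul_right,
      form_ee_self, form_ee_e0, form_e0_ee, form_e0_e0, form_ee_ne H hkl, form_ee_ne H hlk,
      Heisenberg.circ, map_mul, H.bar_bar_eq]
    have ht := Δ.trace_eq hp
    simp only [mul_zero, zero_mul, add_zero, sub_zero, zero_smul]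
    linear_combination (norm := module)
      (H.bar H.lam * z * form H (ee k) w * ht) • (ee l : Idx n → R)
  have h8 : extra k (p.circ z) = ((extra l p)⁻¹ * x * extra l p) * (x⁻¹ *
      (eichler H ((H.bar H.lam * (H.bar z * p.snd)) • ee k) (ee l) 0)⁻¹) := by
    generalize eichler H ((H.bar H.lam * (H.bar z * p.snd)) • ee k) (ee l) 0 = s at key
    generalize extra k (p.circ z) = c at key ⊢
    have h9 : c = (extra l p)⁻¹ * (extra l p * c * s) * s⁻¹ := by group
    rw [h9, ← key]
    group
  rw [h8, two_mul, add_assoc]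
  exact (hxP.conj_inv hW).mul (hxP.inv.mul hyP.inv)

end ShortBound

end Roots

/-! ### Eichler transformations of isotropic pairs -/

section IsotropicPairs

open scoped commutatorElement

variable {R : Type*} [CommRing R] {H : HermitianRing R} {n : ℕ}

theorem form_ee_ee (k l : Hb n) :
    form H (ee k) (ee l) = if k = opp l then H.theta k else 0 := by
  split_ifs with h
  · rw [h, form_opp_ee]
  · exact form_ee_ne H h

theorem ee_apply (k l : Hb n) : (ee k : Idx n → R) (some l) = if l = k then 1 else 0 := by
  split_ifs with h
  · rw [h, ee_self]
  · exact ee_ne h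

/-- The two indices are different up to sign. -/
def Indep (i j : Hb n) : Prop := i ≠ j ∧ i ≠ opp j

namespace Indep

variable {i j : Hb n}

theorem symm (h : Indep i j) : Indep j i :=
  ⟨h.1.symm, fun e => h.2 (by rw [e, opp_opp])⟩

theorem opp_right (h : Indep i j) : Indep i (opp j) := ⟨h.2, by rw [opp_opp]; exact h.1⟩

theorem opp_left (h : Indep i j) : Indep (opp i) j := h.symm.opp_right.symm

/-- All the inequalities needed to evaluate the form `b` on basis vectors. -/
theorem all (h : Indep i j) : (i ≠ j ∧ j ≠ i) ∧ i ≠ opp j ∧ j ≠ opp i :=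
  ⟨⟨h.1, h.1.symm⟩, h.2, h.symm.2⟩

end Indep

theorem ne_opp_self (i : Hb n) : i ≠ opp i := (opp_ne_self i).symm

theorem exists_indep (hn : 3 ≤ n) (k l : Hb n) : ∃ r : Hb n, Indep r k ∧ Indep r l := by
  obtain ⟨r, h1, h2, h3, h4⟩ := exists_third hn k l
  exact ⟨r, ⟨h1, h2⟩, ⟨h3, h4⟩⟩

theorem eichler_add_right {e v v' : Idx n → R} (he : form H e e = 0) (hev : form H e v = 0)
    (hev' : form H e v' = 0) (hvv' : form H v v' = 0) :
    eichler H e (v + v') 0 = eichler H e v 0 * eichler H e v' 0 := by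
  rw [eichler_mul _ _ he hev hev', hvv']
  simp

theorem eichler_smul_self (k : Hb n) (x y : R) :
    eichler H (x • ee k) (y • ee k) 0
      = extra k (⟨0, -(H.bar x * y) - H.bar (-(H.bar x * y)) * H.lam⟩ : Heisenberg H) := by
  apply act_ext
  intro w
  rw [act_extra, act_eichler _ (form_smul_ee_self x k)
    (by simp [form_smul_left, form_smul_right])]
  simp only [form_smul_left, form_ee_left, map_neg, map_mul, H.bar_bar_eq, map_zero]
  have h7 := H.lam_mul_bar_lam
  linear_combination (norm := module)
    (-(x * H.bar y) * H.theta k * w (some (opp k)) * h7) • (ee k : Idx n → R)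

variable {Δ : OddFormParameter H} {σ : GeneralLinearGroup (Idx n) R} {N M : ℕ}

theorem eichler_ee_mem (Δ : OddFormParameter H) {k l : Hb n} (hkl : k ≠ opp l) (x y : R) :
    eichler H (x • ee k) (y • ee l) 0 ∈ elementaryGroup n Δ := by
  by_cases h : k = l
  · rw [← h, eichler_smul_self]
    exact extra_mem Δ (Δ.central_mem _) k
  · exact eichler_short_mem Δ h hkl x y

/-- The transformation `E(u, v)` is elementary if `u` and `v` are linear combinations of two
basis vectors each and all these basis vectors are orthogonal. -/
theorem eichler_mem_of_two (Δ : OddFormParameter H) {i j k l : Hb n} (hij : i ≠ opp j)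
    (hkl : k ≠ opp l) (hik : i ≠ opp k) (hil : i ≠ opp l) (hjk : j ≠ opp k) (hjl : j ≠ opp l)
    (x y z t : R) :
    eichler H (x • ee i + y • ee j) (z • ee k + t • ee l) 0 ∈ elementaryGroup n Δ := by
  have h : ∀ {k l : Hb n} (x y : R), k ≠ opp l → form H (x • ee k) (y • ee l) = 0 :=
    fun x y h => form_smul_ee h x y
  rw [eichler_add_left (h _ _ (ne_opp_self i)) (h _ _ (ne_opp_self j)) (h _ _ hij)
    (by rw [form_add_right, h _ _ hik, h _ _ hil, add_zero])
    (by rw [form_add_right, h _ _ hjk, h _ _ hjl, add_zero])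
    (by rw [form_add_right, form_add_left, form_add_left, h _ _ (ne_opp_self k), h _ _ hkl,
      h _ _ (ne_opp_self l), h _ _ (fun e => hkl (by rw [e, opp_opp]))]; simp),
    eichler_add_right (h _ _ (ne_opp_self i)) (h _ _ hik) (h _ _ hil) (h _ _ hkl),
    eichler_add_right (h _ _ (ne_opp_self j)) (h _ _ hjk) (h _ _ hjl) (h _ _ hkl)]
  exact mul_mem (mul_mem (eichler_ee_mem Δ hik _ _) (eichler_ee_mem Δ hil _ _))
    (mul_mem (eichler_ee_mem Δ hjk _ _) (eichler_ee_mem Δ hjl _ _))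

theorem eichler_ee_right (k : Hb n) (v : Idx n → R) (c : R) (h : form H (ee k) v = 0) :
    eichler H (c • ee k) v 0 = eichler H (ee k) (H.bar c • v) 0 :=
  eichler_smul_left c (form_ee_self H k) h

theorem shortBound_of_pair_right (hn : 3 ≤ n) {k l : Hb n} {z : R} (hkl : Indep k l)
    (h : ∀ y : R, ProdConj Δ σ N (eichler H (ee k) ((y * z) • ee l) 0)) :
    ShortBound Δ σ N z := by
  have h1 : ShortBound Δ σ N (H.bar z) := by
    refine shortBound_of_pair hn hkl.1 hkl.2 fun y => ?_
    rw [eichler_ee_right k _ _ (form_ee_ne H hkl.2), map_mul, H.bar_bar_eq]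
    exact h _
  simpa using h1.bar

/-- The basic commutator trick: if `τ` is elementary and `σ * τ * σ⁻¹` fixes the isotropic vector
`e`, then the part of `[τ * (σ * τ⁻¹ * σ⁻¹), E(e, a)]` that depends on `σ` has the form `E(e, ·)`.
It drops out of two further commutators, with some `E(e, c)` and with an element fixing `e`. What
remains is a commutator of known elements, a product of `16 = 2 ^ 3 * 2` conjugates. -/
theorem ProdConj.commutator_commutator (hσ : Preserves H σ) {τ x : GeneralLinearGroup (Idx n) R}
    {e a c : Idx n → R} (he : form H e e = 0) (ha : form H e a = 0) (hc : form H e c = 0)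
    (hτ : τ ∈ elementaryGroup n Δ) (hfix : act (σ * τ * σ⁻¹) e = e)
    (hg : eichler H e a 0 ∈ elementaryGroup n Δ)
    (hg' : eichler H e c 0 ∈ elementaryGroup n Δ)
    (hx : x ∈ elementaryGroup n Δ) (hxe : act x e = e) :
    ProdConj Δ σ 16
      (⁅⁅eichler H (act τ⁻¹ e) (act τ⁻¹ a) 0, eichler H e c 0⁆, x⁆) := by
  have hτp := preserves_of_mem_elementary hτ
  set g := eichler H e a 0 with hgdef
  set t := eichler H (act τ⁻¹ e) (act τ⁻¹ a) 0
  have ht : t = τ⁻¹ * g * τ := by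
    have := eichler_conj hτp.inv e a 0
    rw [inv_inv] at this
    exact this.symm
  have htE : t ∈ elementaryGroup n Δ := by
    rw [ht]; exact mul_mem (mul_mem (inv_mem hτ) hg) hτ
  set ξ := σ * τ⁻¹ * σ⁻¹ with hξ
  have hξp : Preserves H ξ := (hσ.mul hτp.inv).mul hσ.inv
  have hξe : act ξ e = e := by
    have h1 : ξ = (σ * τ * σ⁻¹)⁻¹ := by rw [hξ]; group
    rw [h1]
    nth_rewrite 1 [← hfix]
    rw [act_inv_act]
  -- `v` is the part of the first commutator that depends on `σ`
  set v := ξ * g⁻¹ * ξ⁻¹ with hv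
  have hv' : v⁻¹ = eichler H e (act ξ a) 0 := by
    rw [hv, ← hξe, ← eichler_conj hξp, ← hgdef]
    group
  have hea : form H e (act ξ a) = 0 := by rw [← hξe, hξp, ha]
  set g' := eichler H e c 0 with hg'def
  have hcen : ∃ κ, v⁻¹ * g' * v * g'⁻¹ = eichler H e 0 κ := by
    have hnc : form H e (-c) = 0 := by rw [form_neg_right, hc, neg_zero]
    have hna : form H e (-act ξ a) = 0 := by rw [form_neg_right, hea, neg_zero]
    have h1 : v = (eichler H e (act ξ a) 0)⁻¹ := by rw [← hv', inv_inv]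
    have h2 : v = _ := h1.trans (eichler_inv _ he hea)
    rw [hv', h2, hg'def, eichler_inv _ he hc, eichler_mul _ _ he hea hc,
      eichler_mul _ _ he (by rw [form_add_right, hea, hc, add_zero]) hna,
      eichler_mul _ _ he (by rw [form_add_right, form_add_right, hea, hc, hna]; simp) hnc]
    have h3 : act ξ a + c + -act ξ a + -c = 0 := by abel
    rw [h3]
    exact ⟨_, rfl⟩
  obtain ⟨κ, hκ⟩ := hcen
  have hcomm : x * eichler H e 0 κ * x⁻¹ = eichler H e 0 κ := by
    rw [eichler_conj (preserves_of_mem_elementary hx), hxe, act_zero]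
  have p1 : ProdConj Δ σ 2 (τ * ξ) := by
    refine (ProdConj.pair hτ (one_mem _)).cast_eq ?_
    rw [hξ]; group
  have p2 : ProdConj Δ σ 4 (v * t) := by
    refine ((p1.commutator (inv_mem hg)).conj_inv hτ).cast_eq ?_
    rw [hv, ht]; group
  have p3 : ProdConj Δ σ 8 (eichler H e 0 κ * ⁅t, g'⁆⁻¹) := by
    refine ((p2.inv.commutator hg').conj htE).cast_eq ?_
    rw [← hκ, commutatorElement_def]; group
  have p4 := p3.inv.commutator hx
  refine p4.cast_eq ?_
  generalize ⁅t, g'⁆ = s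
  generalize eichler H e 0 κ = d at hcomm
  rw [commutatorElement_def]
  have h5 : d⁻¹ * x * d = x := by
    nth_rewrite 1 [← hcomm]
    group
  calc s * x * s⁻¹ * x⁻¹ = s * (d⁻¹ * x * d) * s⁻¹ * x⁻¹ := by rw [h5]
    _ = _ := by group

end IsotropicPairs

/-! ### Products of entries of a row -/

section RowProducts

open scoped commutatorElement

variable {R : Type*} [CommRing R] {H : HermitianRing R} {n : ℕ}
variable {Δ : OddFormParameter H} {σ : GeneralLinearGroup (Idx n) R} {N M : ℕ}

attribute [local simp] form_add_left form_add_right form_sub_left form_sub_right form_neg_left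
  form_neg_right form_smul_left form_smul_right form_ee_ee opp_inj opp_ne_self ne_opp_self
  opp_eq_iff

/-- Row `i` of `σ`, up to a unit, expressed through the form `b`. -/
theorem form_act_inv_ee (hσ : Preserves H σ) (i p : Hb n) :
    form H (act σ⁻¹ (ee (opp i))) (ee p) = H.theta (opp i) * σ.1 (some i) (some p) := by
  rw [hσ.inv.form_act_left, inv_inv, form_ee_left, opp_opp, act_ee]

/-- The isotropic vectors `u = σ_ij e_i - σ_ii e_j` and `v = σ_ij e_m - σ_im e_j` are orthogonal to
`σ⁻¹ e_{-i}`, so the image under `σ` of `E(u, v)` fixes `e_{-i}` and `commutator_commutator`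
applies. -/
theorem shortBound_row_off (hn : 3 ≤ n) (hσ : Preserves H σ) {i j m : Hb n} (hij : Indep i j)
    (him : Indep i m) (hjm : Indep j m) :
    ShortBound Δ σ 16 (σ.1 (some i) (some j) * H.bar (σ.1 (some i) (some m))) := by
  set w := act σ⁻¹ (ee (opp i)) with hw
  set ω : Hb n → R := fun p => form H w (ee p) with hω
  set u : Idx n → R := ω j • ee i + (-ω i) • ee j with hu
  set v : Idx n → R := ω j • ee m + (-ω m) • ee j with hv
  have huu : form H u u = 0 := by simp [hu, hij.all]
  have huv : form H u v = 0 := by simp [hu, hv, hij.all, him.all, hjm.all]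
  have hvv : form H v v = 0 := by simp [hv, hjm.all]
  have hwu : form H w u = 0 := by simp [hu, hω]; ring
  have hwv : form H w v = 0 := by simp [hv, hω]; ring
  set τ := eichler H u v 0 with hτ
  have hτm : τ ∈ elementaryGroup n Δ := eichler_mem_of_two Δ hij.2 hjm.symm.2 him.2 hij.2 hjm.2
    (ne_opp_self j) _ _ _ _
  have hfix : act (σ * τ * σ⁻¹) (ee (opp i)) = ee (opp i) := by
    rw [act_mul, act_mul, ← hw, hτ, eichler_act_fix huu huv (form_eq_zero_symm H hwu)
      (form_eq_zero_symm H hwv), hw, act_act_inv]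
  have hτi : τ⁻¹ = eichler H u (-v) 0 := by
    rw [hτ, eichler_inv _ huu huv, hvv]; simp
  have hunv : form H u (-v) = 0 := by rw [form_neg_right, huv, neg_zero]
  set c := H.bar H.lam * H.bar (ω j) * H.theta i with hc
  have hτe : act τ⁻¹ (ee (opp i)) = ee (opp i) + c • v := by
    rw [hτi, act_eichler _ huu hunv]
    have e1 : form H (-v) (ee (opp i)) = 0 := by simp [hv, hij.symm.all, him.symm.all]
    have e2 : form H u (ee (opp i)) = H.bar (ω j) * H.theta i := by simp [hu, hij.all]
    rw [e1, e2, hc]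
    module
  have hτm' : act τ⁻¹ (ee m) = ee m := by
    rw [hτi]
    exact eichler_act_fix huu hunv (by simp [hu, him.all, hjm.all]) (by simp [hv, hjm.all])
  have key : ∀ x : R, ProdConj Δ σ 16 (eichler H (ee (opp i))
      ((x * (ω j * H.bar (ω m))) • ee j) 0) := by
    intro x
    -- The parameter is chosen so that the units picked up below cancel.
    set y := -(H.theta i * H.bar (H.theta j) * H.bar (H.theta (opp m)) * x) with hy
    set d := ω j * H.bar (ω m) * H.bar (H.theta i) * H.theta j with hd
    set g := eichler H (y • ee j) (ee (opp m)) 0 with hg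
    have hgm : g ∈ elementaryGroup n Δ := by
      have := eichler_ee_mem Δ hjm.opp_right.2 y 1
      rwa [one_smul] at this
    have hgp := preserves_of_mem_elementary hgm
    have hge : act g (ee (opp i)) = ee (opp i) :=
      eichler_act_fix (by simp) (by simp [hjm.all]) (by simp [hij.symm.all])
        (by simp [him.symm.all])
    have hgem : act g (ee m) = ee m + (H.theta (opp m) * y) • ee j := by
      rw [hg, act_eichler _ (by simp) (by simp [hjm.all])]
      simp [hjm.all, smul_smul]
    have ht1 : form H (ee (opp i) + c • v) (ee (opp i) + c • v) = 0 := by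
      simp [hv, hij.all, him.all, hjm.all]
    have ht2 : form H (ee (opp i) + c • v) (ee m) = 0 := by
      simp [hv, him.all, hjm.all]
    have hte : act (eichler H (ee (opp i) + c • v) (ee m) 0) (ee (opp i)) = ee (opp i) :=
      eichler_act_fix ht1 ht2 (by simp [hv, hij.symm.all, him.symm.all]) (by simp [him.symm.all])
    have htj : act (eichler H (ee (opp i) + c • v) (ee m) 0) (ee (opp j))
        = ee (opp j) + d • ee m := by
      rw [act_eichler _ ht1 ht2]
      have e1 : form H (ee m) (ee (opp j)) = (0 : R) := by simp [hjm.symm.all]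
      have e2 : form H (ee (opp i) + c • v) (ee (opp j))
          = -(H.bar c * H.bar (ω m) * H.theta j) := by
        simp [hv, hij.all, hjm.symm.all]
        ring
      have e3 : d = H.bar H.lam * (H.bar c * H.bar (ω m) * H.theta j) := by
        rw [hd, hc]
        simp only [map_mul, H.bar_bar_eq]
        linear_combination (-(ω j * H.bar (ω m) * H.bar (H.theta i) * H.theta j)) *
          H.bar_lam_mul_lam
      rw [e1, e2, e3]
      module
    have h16 := ProdConj.commutator_commutator (Δ := Δ) hσ (form_ee_self H (opp i))
      (a := ee m) (c := ee (opp j)) (by simp [him.all]) (by simp [hij.all]) hτm hfix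
      (by simpa using eichler_ee_mem Δ him.opp_left.2 (1 : R) 1)
      (by simpa using eichler_ee_mem Δ hij.opp_left.opp_right.2 (1 : R) 1) hgm hge
    refine h16.cast_eq ?_
    have htp : Preserves H (eichler H (ee (opp i) + c • v) (ee m) 0) :=
      preserves_eichler ht1 (form_ee_self H m) ht2
    rw [hτe, hτm', commutatorElement_def, commutatorElement_def, eichler_conj htp, hte, htj]
    have e4 : ∀ z : R, form H (ee (opp i)) (z • ee m) = 0 := fun z => by simp [him.all]
    have e5 : form H (ee (opp i)) (ee (opp j)) = 0 := by simp [hij.all]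
    rw [add_comm (ee (opp j)), eichler_add_right (form_ee_self H _) (e4 d) e5
      (by simp [hjm.symm.all]), mul_inv_cancel_right, mul_assoc, mul_assoc, ← mul_assoc g]
    have e7 : g * (eichler H (ee (opp i)) (d • ee m) 0)⁻¹ * g⁻¹
        = eichler H (ee (opp i)) (-(d • (ee m + (H.theta (opp m) * y) • ee j))) 0 := by
      rw [eichler_inv _ (form_ee_self H _) (e4 d), eichler_conj hgp, hge, act_neg, act_smul, hgem]
      simp
    rw [e7, eichler_mul _ _ (form_ee_self H _) (e4 d) (by simp [him.all, hij.all])]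
    congr 1
    · rw [hd, hy]
      have t1 := H.theta_mul_bar i
      have t2 := H.theta_mul_bar j
      have t3 := H.theta_mul_bar (opp m)
      have e8 : ω j * H.bar (ω m) * H.bar (H.theta i) * H.theta j * (H.theta (opp m) *
          -(H.theta i * H.bar (H.theta j) * H.bar (H.theta (opp m)) * x))
          = -(x * (ω j * H.bar (ω m))) * (H.theta i * H.bar (H.theta i)) *
            (H.theta j * H.bar (H.theta j)) * (H.theta (opp m) * H.bar (H.theta (opp m))) := by
        ring
      rw [t1, t2, t3] at e8
      rw [smul_add, smul_smul, e8]
      module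
    · simp [hjm.symm.all]
  refine (shortBound_of_pair_right (z := ω j * H.bar (ω m)) hn hij.opp_left key).of_eq_mul 1 ?_
  have h1 : ω j = H.theta (opp i) * σ.1 (some i) (some j) := form_act_inv_ee hσ i j
  have h2 : ω m = H.theta (opp i) * σ.1 (some i) (some m) := form_act_inv_ee hσ i m
  rw [h1, h2, map_mul]
  linear_combination (-σ.1 (some i) (some j) * H.bar (σ.1 (some i) (some m))) *
    H.theta_mul_bar (opp i)

/-- The argument of `shortBound_row_off` for the vectors `u = σ_ii e_j - σ_ij e_i` and
`v = σ_ii e_m - σ_im e_i`. As both vectors involve `e_i`, the vector `e_{-i}` is moved by a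
combination of `u` and `v`, and one more commutator is needed to isolate a short root element. -/
theorem shortBound_row_diag (hn : 3 ≤ n) (hσ : Preserves H σ) {i j : Hb n} (hij : Indep i j) :
    ShortBound Δ σ 32 (σ.1 (some i) (some i) * H.bar (σ.1 (some i) (some j))) := by
  obtain ⟨m, hmi, hmj⟩ := exists_indep hn i j
  have him := hmi.symm
  have hjm := hmj.symm
  clear hmi hmj
  set w := act σ⁻¹ (ee (opp i)) with hw
  set ω : Hb n → R := fun p => form H w (ee p) with hω
  set u : Idx n → R := ω i • ee j + (-ω j) • ee i with hu
  set v : Idx n → R := ω i • ee m + (-ω m) • ee i with hv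
  have huu : form H u u = 0 := by simp [hu, hij.all]
  have huv : form H u v = 0 := by simp [hu, hv, hij.all, him.all, hjm.all]
  have hvv : form H v v = 0 := by simp [hv, him.all]
  have hwu : form H w u = 0 := by simp [hu, hω]; ring
  have hwv : form H w v = 0 := by simp [hv, hω]; ring
  set τ := eichler H u v 0 with hτ
  have hτm : τ ∈ elementaryGroup n Δ := eichler_mem_of_two Δ hij.symm.2 him.symm.2 hjm.2 hij.symm.2
    him.2 (ne_opp_self i) _ _ _ _
  have hfix : act (σ * τ * σ⁻¹) (ee (opp i)) = ee (opp i) := by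
    rw [act_mul, act_mul, ← hw, hτ, eichler_act_fix huu huv (form_eq_zero_symm H hwu)
      (form_eq_zero_symm H hwv), hw, act_act_inv]
  have hτi : τ⁻¹ = eichler H u (-v) 0 := by
    rw [hτ, eichler_inv _ huu huv, hvv]; simp
  have hunv : form H u (-v) = 0 := by rw [form_neg_right, huv, neg_zero]
  set y : Idx n → R := ee (opp i) + (H.bar (ω m) * H.theta i) • u
    - (H.bar H.lam * H.bar (ω j) * H.theta i) • v with hy
  have hτe : act τ⁻¹ (ee (opp i)) = y := by
    rw [hτi, act_eichler _ huu hunv]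
    have e1 : form H (-v) (ee (opp i)) = H.bar (ω m) * H.theta i := by simp [hv, him.symm.all]
    have e2 : form H u (ee (opp i)) = -(H.bar (ω j) * H.theta i) := by simp [hu, hij.symm.all]
    rw [e1, e2, hy]
    module
  have hτj : act τ⁻¹ (ee j) = ee j := by
    rw [hτi]
    exact eichler_act_fix huu hunv (by simp [hu, hij.all]) (by simp [hv, hij.all, hjm.symm.all])
  have hyy : form H y y = 0 := by rw [← hτe, (preserves_of_mem_elementary hτm).inv, form_ee_self]
  have hyj : form H y (ee j) = 0 := by
    rw [← hτe, ← hτj, (preserves_of_mem_elementary hτm).inv]; simp [hij.all]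
  set D := -(H.bar H.lam * form H y (ee (opp i))) with hD
  set C := H.bar (H.theta i) * H.theta m * ω j * H.bar (ω i) with hC
  have hte : act (eichler H y (ee j) 0) (ee (opp i)) = ee (opp i) + D • ee j := by
    rw [act_eichler _ hyy hyj]
    have e1 : form H (ee j) (ee (opp i)) = (0 : R) := by simp [hij.symm.all]
    rw [e1, hD]
    module
  have htm : act (eichler H y (ee j) 0) (ee (opp m)) = ee (opp m) + C • ee j := by
    rw [act_eichler _ hyy hyj]
    have e1 : form H (ee j) (ee (opp m)) = (0 : R) := by simp [hjm.all]
    have e2 : form H y (ee (opp m)) = -(H.lam * ω j * H.bar (H.theta i) * H.bar (ω i) *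
        H.theta m) := by
      simp [hy, hu, hv, hjm.all, him.all]
      ring
    have e3 : C = H.bar H.lam * (H.lam * ω j * H.bar (H.theta i) * H.bar (ω i) *
        H.theta m) := by
      rw [hC]
      linear_combination (-(ω j * H.bar (H.theta i) * H.bar (ω i) * H.theta m)) *
        H.bar_lam_mul_lam
    rw [e1, e2, e3]
    module
  set g := eichler H (ee (opp m)) (ee (opp j)) 0 with hg
  have hgm : g ∈ elementaryGroup n Δ := by
    simpa using eichler_ee_mem Δ hjm.symm.opp_right.opp_left.2 (1 : R) 1
  have hgp := preserves_of_mem_elementary hgm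
  have hge : act g (ee (opp i)) = ee (opp i) :=
    eichler_act_fix (by simp) (by simp [hjm.symm.all]) (by simp [him.symm.all])
      (by simp [hij.symm.all])
  have hgem : act g (ee (opp m)) = ee (opp m) :=
    eichler_act_fix (by simp) (by simp [hjm.symm.all]) (by simp) (by simp [hjm.all])
  have hgj : act g (ee j) = ee j + H.theta (opp j) • ee (opp m) := by
    rw [hg, act_eichler _ (by simp) (by simp [hjm.symm.all])]
    simp [hjm.symm.all]
  have hem := H.theta_mul_bar (opp j)
  have key : ∀ x : R, ProdConj Δ σ 32 (eichler H (ee (opp m))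
      ((x * (ω i * H.bar (ω j))) • ee j) 0) := by
    intro x
    -- The parameter is chosen so that the units picked up below cancel.
    set Y := H.bar (H.bar (H.theta i) * H.bar (H.theta i) * H.theta m * H.theta (opp j) * x) with hY
    set δ := -(H.bar H.lam * H.bar Y * H.theta i) with hδ
    set f := eichler H (Y • ee i) (ee j) 0 with hf
    have hfm : f ∈ elementaryGroup n Δ := by
      simpa using eichler_ee_mem Δ hij.2 Y 1
    have hfp := preserves_of_mem_elementary hfm
    have hfe : act f (ee (opp i)) = ee (opp i) + δ • ee j := by
      rw [hf, act_eichler _ (by simp) (by simp [hij.all])]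
      have e1 : form H (ee j) (ee (opp i)) = (0 : R) := by simp [hij.symm.all]
      have e2 : form H (Y • ee i) (ee (opp i)) = H.bar Y * H.theta i := by simp
      rw [e1, e2, hδ]
      module
    have hfj : act f (ee j) = ee j :=
      eichler_act_fix (by simp) (by simp [hij.all]) (by simp [hij.all]) (by simp)
    have hfem : act f (ee (opp m)) = ee (opp m) :=
      eichler_act_fix (by simp) (by simp [hij.all]) (by simp [him.all]) (by simp [hjm.all])
    have h16 := ProdConj.commutator_commutator (Δ := Δ) hσ (form_ee_self H (opp i))
      (a := ee j) (c := ee (opp m)) (by simp [hij.all]) (by simp [him.all]) hτm hfix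
      (by simpa using eichler_ee_mem Δ hij.opp_left.2 (1 : R) 1)
      (by simpa using eichler_ee_mem Δ him.opp_left.opp_right.2 (1 : R) 1) hgm hge
    refine (h16.commutator hfm).cast_eq ?_
    have htp : Preserves H (eichler H y (ee j) 0) := preserves_eichler hyy (form_ee_self H j) hyj
    set P := eichler H (ee (opp i) + D • ee j) (ee (opp m) + C • ee j) 0 with hP
    set Q := eichler H (ee (opp i)) (ee (opp m)) 0 with hQ
    have k1 : ⁅eichler H (act τ⁻¹ (ee (opp i))) (act τ⁻¹ (ee j)) 0, Q⁆ = P * Q⁻¹ := by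
      rw [hτe, hτj, commutatorElement_def, hQ, eichler_conj htp, hte, htm]
    -- `g` fixes `Q`, so that only `P` and its conjugates survive in the commutators.
    have k2 : g * Q * g⁻¹ = Q := by rw [hQ, eichler_conj hgp, hge, hgem]
    have k3 : ⁅P * Q⁻¹, g⁆ = P * (g * P * g⁻¹)⁻¹ := by
      rw [commutatorElement_def]
      calc P * Q⁻¹ * g * (P * Q⁻¹)⁻¹ * g⁻¹ = P * Q⁻¹ * (g * Q * g⁻¹) * (g * P * g⁻¹)⁻¹ := by group
        _ = _ := by rw [k2, inv_mul_cancel_right]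
    have k4 : g * P * g⁻¹ = eichler H (ee (opp i) + D • (ee j + H.theta (opp j) • ee (opp m)))
        (ee (opp m) + C • (ee j + H.theta (opp j) • ee (opp m))) 0 := by
      rw [hP, eichler_conj hgp, act_add, act_add, act_smul, act_smul, hge, hgj, hgem]
    have k5 : f * P * f⁻¹ = P * eichler H (δ • ee j) (ee (opp m) + C • ee j) 0 := by
      rw [hP, eichler_conj hfp, act_add, act_add, act_smul, act_smul, hfe, hfj, hfem,
        add_right_comm, eichler_add_left]
      all_goals simp [hij.all, him.all, hjm.all]
    have k6 : f * (g * P * g⁻¹) * f⁻¹ = g * P * g⁻¹ * eichler H (δ • ee j)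
        (ee (opp m) + C • (ee j + H.theta (opp j) • ee (opp m))) 0 := by
      rw [k4, eichler_conj hfp, act_add, act_add, act_smul, act_smul, act_add, act_smul, hfe, hfj,
        hfem, add_right_comm, eichler_add_left]
      all_goals simp [hij.all, him.all, hjm.all]
    have k7 : eichler H (δ • ee j) (ee (opp m) + C • (ee j + H.theta (opp j) • ee (opp m))) 0
        = eichler H (δ • ee j) ((C * H.theta (opp j)) • ee (opp m)) 0
          * eichler H (δ • ee j) (ee (opp m) + C • ee j) 0 := by
      rw [smul_add, ← add_assoc, add_comm _ (C • H.theta (opp j) • ee (opp m)), smul_smul,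
        eichler_add_right]
      all_goals simp [hjm.all]
    have hPp : Preserves H P := by
      refine preserves_eichler ?_ ?_ ?_
      all_goals simp [hij.all, him.all, hjm.all]
    have k8 : P * eichler H (δ • ee j) ((C * H.theta (opp j)) • ee (opp m)) 0 * P⁻¹
        = eichler H (δ • ee j) ((C * H.theta (opp j)) • ee (opp m)) 0 := by
      rw [eichler_conj hPp, act_smul, act_smul, hP, eichler_act_fix, eichler_act_fix]
      all_goals simp [hij.all, him.all, hjm.all]
    have k9 : eichler H (δ • ee j) ((C * H.theta (opp j)) • ee (opp m)) 0
        = eichler H (ee (opp m)) ((x * (ω i * H.bar (ω j))) • ee j) 0 := by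
      rw [eichler_swap (by simp) (by simp) (by simp [hjm.all]), eichler_ee_right]
      · rw [smul_smul, smul_smul]
        congr 2
        simp only [hδ, hY, hC, map_mul, H.bar_bar_eq]
        have t1 := H.theta_mul_bar i
        have t2 := H.theta_mul_bar m
        calc _ = x * (ω i * H.bar (ω j)) * (H.lam * H.bar H.lam) * (H.theta i * H.bar (H.theta i))
              * (H.theta i * H.bar (H.theta i)) * (H.theta m * H.bar (H.theta m))
              * (H.theta (opp j) * H.bar (H.theta (opp j))) := by ring
          _ = _ := by rw [t1, t2, hem, H.lam_mul_bar_lam]; ring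
      · simp [hjm.symm.all]
    rw [k1, k3, ← k9, ← k8]
    calc _ = P * (g * P * g⁻¹)⁻¹ * (f * (g * P * g⁻¹) * f⁻¹) * (f * P * f⁻¹)⁻¹ := by
          rw [k6, k5, k7]
          group
      _ = _ := by group
  refine (shortBound_of_pair_right (z := ω i * H.bar (ω j)) hn hjm.symm.opp_left key).of_eq_mul
    1 ?_
  have h1 : ω i = H.theta (opp i) * σ.1 (some i) (some i) := form_act_inv_ee hσ i i
  have h2 : ω j = H.theta (opp i) * σ.1 (some i) (some j) := form_act_inv_ee hσ i j
  rw [h1, h2, map_mul]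
  linear_combination (-σ.1 (some i) (some i) * H.bar (σ.1 (some i) (some j))) *
    H.theta_mul_bar (opp i)

end RowProducts

/-! ### Entries of the matrix -/

section Entries

variable {R : Type*} [CommRing R] {H : HermitianRing R} {n : ℕ}
variable {Δ : OddFormParameter H} {σ : GeneralLinearGroup (Idx n) R} {N M : ℕ}

attribute [local simp] form_add_left form_add_right form_sub_left form_sub_right form_neg_left
  form_neg_right form_smul_left form_smul_right form_ee_ee opp_inj opp_ne_self ne_opp_self
  opp_eq_iff

/-- Let `φ` be the commutator of `σ⁻¹` with the short root element `E(s e_p, e_{-i})`, where `s` is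
the conjugate of `σ i j` up to a unit. The products of the entries of row `i` show that `φ p i` is,
up to a unit, `s * φ p p` and that `s * φ p p * bar (φ p p)` is `s`, modulo controlled elements;
thus `shortBound_row_diag`, applied to row `p` of `φ`, controls `s`. -/
theorem shortBound_entry (hn : 3 ≤ n) (hσ : Preserves H σ) {i j : Hb n} (hij : Indep i j) :
    ShortBound Δ σ 160 (σ.1 (some i) (some j)) := by
  obtain ⟨p, hpi, hpj⟩ := exists_indep hn i j
  set w := act σ⁻¹ (ee (opp i))
  set f := act σ⁻¹ (ee p) with hf
  set ω : Hb n → R := fun q => form H w (ee q) with hω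
  have hωσ : ∀ q, ω q = H.theta (opp i) * σ.1 (some i) (some q) := form_act_inv_ee hσ i
  have hw' : ω (opp p) = H.bar (w (some p)) * H.theta p := by
    simp only [hω, form_ee_right, opp_opp]
  set s := H.bar (ω j) with hs
  set t := eichler H (s • ee p) (ee (opp i)) 0 with ht
  have htm : t ∈ elementaryGroup n Δ := by
    simpa using eichler_ee_mem Δ hpi.opp_right.2 s 1
  have htp := preserves_of_mem_elementary htm
  have h1 : form H (s • ee p) (s • ee p) = 0 := by simp
  have h2 : form H (s • ee p) (ee (opp i)) = 0 := by simp [hpi.all]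
  have hf1 : form H (s • f) (s • f) = 0 := by
    rw [hf, ← act_smul, hσ.inv, h1]
  have hf2 : form H (s • f) w = 0 := by
    rw [hf, ← act_smul, hσ.inv, h2]
  set φ := σ⁻¹ * t * σ * t⁻¹ with hφ
  have hφp : Preserves H φ := ((hσ.inv.mul htp).mul hσ).mul htp.inv
  have hφσ : ProdConj Δ σ 2 φ := by
    refine (ProdConj.pair_inv (one_mem _) htm).cast_eq ?_
    rw [hφ]; group
  have hconj : σ⁻¹ * t * σ = eichler H (s • f) w 0 := by
    have := eichler_conj hσ.inv (s • ee p) (ee (opp i)) 0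
    rw [inv_inv, act_smul] at this
    exact this
  have htp' : act t⁻¹ (ee p) = ee p := act_inv_fix (eichler_act_fix h1 h2 (by simp)
    (by simp [hpi.symm.all]))
  have hti : act t⁻¹ (ee i) = ee i - (H.theta (opp i) * s) • ee p := by
    have : act t (ee i) = ee i + (H.theta (opp i) * s) • ee p := by
      rw [ht, act_eichler _ h1 h2]
      simp [hpi.all, smul_smul]
    have h3 := congrArg (act t⁻¹) this
    rw [act_inv_act, act_add, act_smul, htp'] at h3
    rw [eq_sub_iff_add_eq]
    exact h3.symm
  have hφpp : φ.1 (some p) (some p) = 1 + s * ω p * f (some p)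
      - H.bar H.lam * H.bar s * form H f (ee p) * w (some p) := by
    rw [← act_ee, hφ, act_mul, htp', hconj, act_eichler _ hf1 hf2]
    simp [hω]
    ring
  have hφpi : φ.1 (some p) (some i) = s * ω i * f (some p)
      - H.bar H.lam * H.bar s * form H f (ee i) * w (some p)
      - H.theta (opp i) * s * φ.1 (some p) (some p) := by
    have : act φ (ee i) = act (eichler H (s • f) w 0) (ee i)
        - (H.theta (opp i) * s) • act φ (ee p) := by
      rw [hφ, act_mul _ t⁻¹, act_mul _ t⁻¹, hti, htp', hconj, act_sub, act_smul]
    rw [← act_ee, ← act_ee, this, act_eichler _ hf1 hf2]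
    simp [hω, ee_apply, hpi.all]
    ring
  have b0 : ShortBound Δ σ 64 (φ.1 (some p) (some p) * H.bar (φ.1 (some p) (some i))) :=
    (shortBound_row_diag hn hφp hpi).trans hφσ
  have hu := H.theta_mul_bar (opp i)
  have b1 : ShortBound Δ σ 32 (H.bar s * H.bar (ω i)) := by
    refine (shortBound_row_diag hn hσ hij).bar.of_eq_mul 1 ?_
    simp only [hs, H.bar_bar_eq, hωσ, map_mul]
    linear_combination (σ.1 (some i) (some j) * H.bar (σ.1 (some i) (some i))) * hu
  have row : ∀ q, Indep q i → Indep q j → ShortBound Δ σ 16 (s * ω q) := by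
    intro q hqi hqj
    refine (shortBound_row_off hn hσ hqi.symm hij hqj).of_eq_mul 1 ?_
    simp only [hs, hωσ, map_mul]
    linear_combination (σ.1 (some i) (some q) * H.bar (σ.1 (some i) (some j))) * hu
  have b2 := row p hpi hpj
  have b3 : ShortBound Δ σ 16 (s * H.bar (w (some p))) := by
    refine (row (opp p) hpi.opp_left hpj.opp_left).of_eq_mul (H.bar (H.theta p)) ?_
    rw [hw']
    linear_combination (-(s * H.bar (w (some p)))) * H.theta_mul_bar p
  have b2' : ShortBound Δ σ 16 (H.bar s * H.bar (ω p)) := by simpa using b2.bar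
  have b3' : ShortBound Δ σ 16 (H.bar s * w (some p)) := by simpa using b3.bar
  clear_value φ
  set P := φ.1 (some p) (some p)
  -- The coefficients come from expanding `P * bar (φ p i)` and then `P * bar P`.
  refine ((((((b0.mul (-1)).add (b1.mul (P * H.bar (f (some p))))).add
    (b2.mul (-(H.bar (H.theta (opp i)) * H.bar s * f (some p))))).add
    (b3'.mul (H.bar (H.theta (opp i)) * H.bar s * H.bar H.lam * form H f (ee p)))).add
    (b2'.mul (-(H.bar (H.theta (opp i)) * H.bar s * P * H.bar (f (some p)))))).add
    (b3.mul (-(P * H.lam * H.bar (form H f (ee i))) + H.bar (H.theta (opp i)) * H.bar s * P *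
      H.lam * H.bar (form H f (ee p))))).of_eq_mul 1 ?_
  have hPb : H.bar P = 1 + H.bar s * H.bar (ω p) * H.bar (f (some p))
      - H.lam * s * H.bar (form H f (ee p)) * H.bar (w (some p)) := by
    rw [hφpp]; simp
  have hsσ : σ.1 (some i) (some j) = H.bar (H.theta (opp i)) * H.bar s := by
    rw [hs, H.bar_bar_eq, hωσ]
    linear_combination (-σ.1 (some i) (some j)) * hu
  rw [hφpi, hsσ]
  simp only [map_mul, map_sub, H.bar_bar_eq]
  linear_combination (-(H.bar (H.theta (opp i)) * H.bar s)) * hφpp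
    - (H.bar (H.theta (opp i)) * H.bar s * P) * hPb

/-- Off-diagonal entries of the commutator of `σ` with `E(e_j, e_m)` show that `σ j j` is inverse to
`bar (σ m m)` modulo controlled elements. -/
theorem shortBound_one_sub (hn : 3 ≤ n) (hσ : Preserves H σ) {j m : Hb n} (hjm : Indep j m) :
    ShortBound Δ σ 640 (1 - σ.1 (some j) (some j) * H.bar (σ.1 (some m) (some m))) := by
  set t := eichler H (ee j) (ee m) 0 with ht
  have htm : t ∈ elementaryGroup n Δ := by simpa using eichler_ee_mem Δ hjm.2 (1 : R) 1
  have htp := preserves_of_mem_elementary htm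
  have h2 : form H (ee j) (ee m) = 0 := by simp [hjm.all]
  set φ := σ * t * σ⁻¹ * t⁻¹ with hφ
  have hφp : Preserves H φ := ((hσ.mul htp).mul hσ.inv).mul htp.inv
  have hφσ : ProdConj Δ σ 2 φ := by
    refine (ProdConj.pair (one_mem _) htm).cast_eq ?_
    rw [hφ]; group
  have htj : act t⁻¹ (ee j) = ee j :=
    act_inv_fix (eichler_act_fix (by simp) h2 (by simp) (by simp [hjm.symm.all]))
  have hti : act t⁻¹ (ee (opp m)) = ee (opp m) - H.theta m • ee j := by
    have : act t (ee (opp m)) = ee (opp m) + H.theta m • ee j := by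
      rw [ht, act_eichler _ (by simp) h2]
      simp [hjm.all]
    have h3 := congrArg (act t⁻¹) this
    rw [act_inv_act, act_add, act_smul, htj] at h3
    rw [eq_sub_iff_add_eq]
    exact h3.symm
  have h3 : form H (act σ (ee j)) (act σ (ee j)) = 0 := by rw [hσ, form_ee_self]
  have h4 : form H (act σ (ee j)) (act σ (ee m)) = 0 := by rw [hσ, h2]
  set c := form H (act σ (ee j)) (ee (opp m) - H.theta m • ee j) with hc
  have hentry : φ.1 (some j) (some (opp m)) = -H.theta m
      + (H.bar (σ.1 (some m) (some m)) * H.theta m - H.theta m *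
        (H.bar (σ.1 (some (opp j)) (some m)) * H.theta (opp j))) * σ.1 (some j) (some j)
      - H.bar H.lam * c * σ.1 (some j) (some m) := by
    rw [← act_ee, hφ, act_mul, hti, eichler_conj hσ, act_eichler _ h3 h4, ← hc]
    rw [form_sub_right, form_smul_right, form_ee_right, form_ee_right]
    simp [act_ee, ee_apply, hjm.all]
  have b0 : ShortBound Δ σ 320 (φ.1 (some j) (some (opp m))) :=
    (shortBound_entry hn hφp hjm.opp_right).trans hφσ
  have b1 : ShortBound Δ σ 160 (σ.1 (some j) (some m)) := shortBound_entry hn hσ hjm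
  have b2 : ShortBound Δ σ 160 (H.bar (σ.1 (some (opp j)) (some m))) :=
    (shortBound_entry hn hσ hjm.opp_left).bar
  refine (((b0.mul (-H.bar (H.theta m))).add (b1.mul (-H.bar (H.theta m) * H.bar H.lam * c))).add
    (b2.mul (-H.theta (opp j) * σ.1 (some j) (some j)))).of_eq_mul 1 ?_
  rw [hentry]
  linear_combination (-1 + σ.1 (some j) (some j) * H.bar (σ.1 (some m) (some m))
    - H.theta (opp j) * σ.1 (some j) (some j) * H.bar (σ.1 (some (opp j)) (some m))) *
    H.theta_mul_bar m

/-- An elementary matrix that adds coordinate `i` to coordinate `j`. -/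
theorem exists_transvection (Δ : OddFormParameter H) {i j : Hb n} (hij : Indep i j) :
    ∃ g ∈ elementaryGroup n Δ, (∀ w : Idx n → R, act g w (some j) = w (some j) + w (some i)) ∧
      act g⁻¹ (ee (opp i)) = ee (opp i) ∧ act g⁻¹ (ee i) = ee i - ee j := by
  set x := H.bar (H.theta (opp i)) with hx
  have hu := H.theta_mul_bar (opp i)
  rw [← hx] at hu
  have hji := hij.symm
  refine ⟨eichler H (x • ee j) (ee (opp i)) 0, ?_, fun w => ?_, ?_, ?_⟩
  · simpa using eichler_ee_mem Δ hji.opp_right.2 x 1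
  · rw [act_short hji.opp_right.2]
    simp only [opp_opp, Pi.add_apply, Pi.sub_apply, Pi.smul_apply, smul_eq_mul, ee_self]
    rw [ee_ne hji.2]
    linear_combination w (some i) * hu
  · exact act_inv_fix (eichler_act_fix (by simp) (by simp [hij.all]) (by simp [hij.all])
      (by simp))
  · have h1 : act (eichler H (x • ee j) (ee (opp i)) 0) (ee j) = ee j :=
      eichler_act_fix (by simp) (by simp [hij.all]) (by simp) (by simp [hij.all])
    have h2 : act (eichler H (x • ee j) (ee (opp i)) 0) (ee i) = ee i + ee j := by
      rw [act_short hji.opp_right.2]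
      simp [hu, ee_apply, hij.all]
    have h3 := congrArg (act (eichler H (x • ee j) (ee (opp i)) 0)⁻¹) h2
    rw [act_inv_act, act_add, act_inv_fix h1] at h3
    rw [eq_sub_iff_add_eq]
    exact h3.symm

theorem shortBound_entry_opp (hn : 3 ≤ n) (hσ : Preserves H σ) (i : Hb n) :
    ShortBound Δ σ 320 (σ.1 (some i) (some (opp i))) := by
  obtain ⟨j, hji, -⟩ := exists_indep hn i i
  obtain ⟨g, hg, hg1, hg2, -⟩ := exists_transvection Δ hji.symm
  have hgp := preserves_of_mem_elementary hg
  have b0 : ShortBound Δ σ 160 ((g * σ * g⁻¹).1 (some j) (some (opp i))) :=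
    (shortBound_entry hn ((hgp.mul hσ).mul hgp.inv) hji.opp_right).of_conj hg
  have b1 : ShortBound Δ σ 160 (σ.1 (some j) (some (opp i))) :=
    shortBound_entry hn hσ hji.opp_right
  refine (b0.add (b1.mul (-1))).of_eq_mul 1 ?_
  rw [← act_ee (g * σ * g⁻¹), act_mul, act_mul, hg2, hg1, act_ee, act_ee]
  ring

theorem shortBound_diag_sub (hn : 3 ≤ n) (hσ : Preserves H σ) {i j : Hb n} (hij : Indep i j) :
    ShortBound Δ σ 480 (σ.1 (some i) (some i) - σ.1 (some j) (some j)) := by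
  obtain ⟨g, hg, hg1, -, hg2⟩ := exists_transvection Δ hij
  have hgp := preserves_of_mem_elementary hg
  have b0 : ShortBound Δ σ 160 ((g * σ * g⁻¹).1 (some j) (some i)) :=
    (shortBound_entry hn ((hgp.mul hσ).mul hgp.inv) hij.symm).of_conj hg
  refine ((b0.add ((shortBound_entry hn hσ hij.symm).mul (-1))).add
    (shortBound_entry hn hσ hij)).of_eq_mul 1 ?_
  rw [← act_ee (g * σ * g⁻¹), act_mul, act_mul, hg2, hg1, act_sub, Pi.sub_apply, Pi.sub_apply,
    act_ee, act_ee, act_ee, act_ee]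
  ring

theorem shortBound_diag_sub_opp (hn : 3 ≤ n) (hσ : Preserves H σ) (i : Hb n) :
    ShortBound Δ σ 960 (σ.1 (some i) (some i) - σ.1 (some (opp i)) (some (opp i))) := by
  obtain ⟨j, hji, -⟩ := exists_indep hn i i
  refine ((shortBound_diag_sub hn hσ hji.symm).add
    (shortBound_diag_sub hn hσ hji.opp_right)).of_eq_mul 1 ?_
  ring

theorem shortBound_column_zero (hn : 3 ≤ n) (hσ : Preserves H σ) (i : Hb n) {a : R}
    (ha : a ∈ Δ.J) : ShortBound Δ σ 480 (σ.1 (some i) none * a) := by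
  obtain ⟨k, hki, -⟩ := exists_indep hn i i
  have hik := hki.symm
  obtain ⟨c, hc⟩ := ha
  -- The entry `(i, -k)` of the conjugate of `σ` by `g` involves `σ i 0 * a`.
  set g := (extra k (⟨a, c⟩ : Heisenberg H))⁻¹ with hg
  have hgm : g ∈ elementaryGroup n Δ := inv_mem (extra_mem Δ hc k)
  have hgp := preserves_of_mem_elementary hgm
  have b0 : ShortBound Δ σ 160 ((g * σ * g⁻¹).1 (some i) (some (opp k))) :=
    (shortBound_entry hn ((hgp.mul hσ).mul hgp.inv) hik.opp_right).of_conj hgm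
  have h1 : act g⁻¹ (ee (opp k)) = ee (opp k) - (H.bar H.lam * H.theta k * a) • e0
      + (H.bar H.lam * H.theta k * c) • ee k := by
    rw [hg, inv_inv, act_extra]
    simp only [ee_none, ee_self]
    module
  have h2 : ∀ w : Idx n → R, act g w (some i) = w (some i) := by
    intro w
    have h3 : ∀ w : Idx n → R, act (extra k (⟨a, c⟩ : Heisenberg H)) w (some i) = w (some i) := by
      intro w
      rw [act_extra]
      simp [ee_apply, hik.all]
    rw [← h3 (act g w), hg, act_act_inv]
  refine ((((b0.mul (-1)).add (shortBound_entry hn hσ hik.opp_right)).add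
    ((shortBound_entry hn hσ hik).mul (H.bar H.lam * H.theta k * c)))).of_eq_mul
    (H.lam * H.bar (H.theta k)) ?_
  rw [← act_ee (g * σ * g⁻¹), act_mul, act_mul, h1, h2, act_add, act_sub, act_smul, act_smul]
  simp only [Pi.add_apply, Pi.sub_apply, Pi.smul_apply, smul_eq_mul, act_ee, act_e0]
  have t1 := H.theta_mul_bar k
  have t2 := H.lam_mul_bar_lam
  linear_combination (-(σ.1 (some i) none * a)) * t1 - (H.theta k * H.bar (H.theta k) *
    (σ.1 (some i) none * a)) * t2

theorem shortBound_row_zero (hn : 3 ≤ n) (hσ : Preserves H σ) (j : Hb n) {a : R}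
    (ha : a ∈ Δ.J) : ShortBound Δ σ 480 (H.bar a * H.mu * σ.1 none (some j)) := by
  obtain ⟨k, hkj, -⟩ := exists_indep hn j j
  obtain ⟨c, hc⟩ := ha
  set g := extra k (⟨a, c⟩ : Heisenberg H) with hg
  have hgm : g ∈ elementaryGroup n Δ := extra_mem Δ hc k
  have hgp := preserves_of_mem_elementary hgm
  have b0 : ShortBound Δ σ 160 ((g * σ * g⁻¹).1 (some k) (some j)) :=
    (shortBound_entry hn ((hgp.mul hσ).mul hgp.inv) hkj).of_conj hgm
  have h1 : act g⁻¹ (ee j) = ee j := by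
    apply act_inv_fix
    rw [hg, act_extra]
    simp [ee_apply, hkj.all]
  refine ((((b0.add ((shortBound_entry hn hσ hkj).mul (-1))).add
    ((shortBound_entry hn hσ hkj.opp_left).mul (-(H.bar H.lam * H.theta k * c)))))).of_eq_mul
    1 ?_
  rw [← act_ee (g * σ * g⁻¹), act_mul, act_mul, h1, hg, act_extra]
  simp only [Pi.add_apply, Pi.sub_apply, Pi.smul_apply, smul_eq_mul, act_ee, ee_self, e0_some]
  ring

end Entries

/-! ### Coordinates of Eichler transformations -/

section Coordinates

variable {R : Type*} [CommRing R] {H : HermitianRing R} {n : ℕ}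
variable {Δ : OddFormParameter H} {σ : GeneralLinearGroup (Idx n) R} {N M : ℕ}

theorem form_sum_left {ι : Type*} (s : Finset ι) (v : ι → Idx n → R) (w : Idx n → R) :
    form H (∑ r ∈ s, v r) w = ∑ r ∈ s, form H (v r) w := by
  classical
  induction s using Finset.induction_on with
  | empty => simp
  | insert r s hr ih => rw [Finset.sum_insert hr, Finset.sum_insert hr, form_add_left, ih]

theorem form_sum_right {ι : Type*} (s : Finset ι) (v : ι → Idx n → R) (w : Idx n → R) :
    form H w (∑ r ∈ s, v r) = ∑ r ∈ s, form H w (v r) := by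
  classical
  induction s using Finset.induction_on with
  | empty => simp
  | insert r s hr ih => rw [Finset.sum_insert hr, Finset.sum_insert hr, form_add_right, ih]

theorem ProdConj.eichler_sum {ι : Type*} (s : Finset ι) (v : ι → Idx n → R) (N : ι → ℕ)
    {e : Idx n → R} (he : form H e e = 0) (h1 : ∀ r, form H e (v r) = 0)
    (h2 : ∀ r r', form H (v r) (v r') = 0)
    (h3 : ∀ r ∈ s, ProdConj Δ σ (N r) (eichler H e (v r) 0)) :
    ProdConj Δ σ (∑ r ∈ s, N r) (eichler H e (∑ r ∈ s, v r) 0) := by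
  classical
  induction s using Finset.induction_on with
  | empty => simpa [eichler_zero] using ProdConj.one
  | insert r s hr ih =>
    rw [Finset.sum_insert hr, Finset.sum_insert hr, eichler_add_right he (h1 r)
      (by rw [form_sum_right]; exact Finset.sum_eq_zero fun r' _ => h1 r')
      (by rw [form_sum_right]; exact Finset.sum_eq_zero fun r' _ => h2 r r')]
    exact (h3 r (Finset.mem_insert_self r s)).mul
      (ih fun r' hr' => h3 r' (Finset.mem_insert_of_mem hr'))

/-- The part of a vector supported on the positive indices. -/
def posPart (f : Idx n → R) : Idx n → R := ∑ r, f (some (Sum.inl r)) • ee (Sum.inl r)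

/-- The part of a vector supported on the negative indices. -/
def negPart (f : Idx n → R) : Idx n → R := ∑ r, f (some (Sum.inr r)) • ee (Sum.inr r)

theorem decompose (f : Idx n → R) : f = posPart f + negPart f + f none • e0 := by
  funext r
  simp only [posPart, negPart, Pi.add_apply, Finset.sum_apply, Pi.smul_apply, smul_eq_mul]
  rcases r with _ | r | r <;> simp [ee_apply, Finset.sum_ite_eq]

theorem form_pos_neg (f : Idx n → R) : form H (posPart f) (negPart f) = (quad H f).snd := by
  simp [posPart, negPart, form, ee_apply, Finset.sum_apply, quad]

/-- Splitting off the positive and the negative part of `f` from `E(e_k, f)` leaves the extra short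
root element with parameter `q(f)`. -/
theorem eichler_decompose (k : Hb n) {f : Idx n → R}
    (h1 : form H (ee k) (posPart f) = 0) (h2 : form H (ee k) (negPart f) = 0) :
    eichler H (ee k) f 0 = eichler H (ee k) (posPart f) 0 * eichler H (ee k) (negPart f) 0
      * extra k (quad H f) := by
  have h3 : form H (posPart f) (e0 : Idx n → R) = 0 := by
    simp [posPart, form_sum_left, form_smul_left]
  have h4 : form H (negPart f) (e0 : Idx n → R) = 0 := by
    simp [negPart, form_sum_left, form_smul_left]
  rw [extra, eichler_mul _ _ (form_ee_self H k) h1 h2, eichler_mul _ _ (form_ee_self H k)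
    (by rw [form_add_right, h1, h2, add_zero]) (by simp [form_smul_right]), form_pos_neg]
  congr 1
  · exact decompose f
  · rw [form_smul_right, form_add_left, h3, h4]
    ring

theorem posPart_add (f g : Idx n → R) : posPart (f + g) = posPart f + posPart g := by
  simp [posPart, add_smul, Finset.sum_add_distrib]

theorem negPart_add (f g : Idx n → R) : negPart (f + g) = negPart f + negPart g := by
  simp [negPart, add_smul, Finset.sum_add_distrib]

theorem posPart_inl (c : R) (j : Fin n) :
    posPart (c • ee (Sum.inl j)) = (c • ee (Sum.inl j) : Idx n → R) := by
  simp [posPart, ee_apply, ite_smul]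

theorem posPart_inr (c : R) (j : Fin n) :
    posPart (c • ee (Sum.inr j)) = (0 : Idx n → R) := by
  simp [posPart, ee_apply]

theorem negPart_inr (c : R) (j : Fin n) :
    negPart (c • ee (Sum.inr j)) = (c • ee (Sum.inr j) : Idx n → R) := by
  simp [negPart, ee_apply, ite_smul]

theorem negPart_inl (c : R) (j : Fin n) :
    negPart (c • ee (Sum.inl j)) = (0 : Idx n → R) := by
  simp [negPart, ee_apply]

/-- If the coordinates of `f + c e_j` are small, then the extra short root element belonging to
`q(f)` differs from `E(e_k, f) * E(e_k, c e_j)` by a bounded number of factors only. -/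
theorem ProdConj.extra_quad_of_coords {k j : Hb n} (hjk : Indep j k) {f : Idx n → R}
    (hf : form H (ee k) f = 0) (c : R) (N : Hb n → ℕ)
    (hM : ProdConj Δ σ M (eichler H (ee k) f 0 * eichler H (ee k) (c • ee j) 0))
    (hN : ∀ p, ProdConj Δ σ (N p)
      (eichler H (ee k) ((f + c • ee j : Idx n → R) (some p) • ee p) 0)) :
    ProdConj Δ σ (M + ∑ p, N p) (extra k (quad H f)) := by
  have hk := form_ee_self H (R := R) k
  have hfk : f (some (opp k)) = 0 := by
    have h := hf
    rw [form_ee_left] at h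
    linear_combination H.bar (H.theta k) * h - f (some (opp k)) * H.theta_mul_bar k
  have hcoord : ∀ p : Hb n, form H (ee k) (f (some p) • ee p) = 0 := by
    intro p
    by_cases hp : p = opp k
    · rw [hp, hfk]; simp
    · rw [form_smul_right, form_ee_ne H (fun h => hp (by rw [h, opp_opp])), mul_zero]
  have hcj : form H (ee k) (c • ee j) = 0 := by
    rw [form_smul_right, form_ee_ne H hjk.symm.2, mul_zero]
  have hcoord' : ∀ p : Hb n, form H (ee k) ((f + c • ee j : Idx n → R) (some p) • ee p) = 0 := by
    intro p
    by_cases hp : p = opp k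
    · rw [hp, Pi.add_apply, hfk, Pi.smul_apply, ee_ne hjk.2.symm]; simp
    · rw [form_smul_right, form_ee_ne H (fun h => hp (by rw [h, opp_opp])), mul_zero]
  have h1 : form H (ee k) (posPart f) = 0 := by
    rw [posPart, form_sum_right]
    exact Finset.sum_eq_zero fun r _ => hcoord _
  have h2 : form H (ee k) (negPart f) = 0 := by
    rw [negPart, form_sum_right]
    exact Finset.sum_eq_zero fun r _ => hcoord _
  have hP : ProdConj Δ σ (∑ r, N (Sum.inl r)) (eichler H (ee k) (posPart (f + c • ee j)) 0) :=
    ProdConj.eichler_sum _ _ _ hk (fun r => hcoord' _)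
      (fun r r' => form_smul_ee (by simp [opp]) _ _) (fun r _ => hN _)
  have hQ : ProdConj Δ σ (∑ r, N (Sum.inr r)) (eichler H (ee k) (negPart (f + c • ee j)) 0) :=
    ProdConj.eichler_sum _ _ _ hk (fun r => hcoord' _)
      (fun r r' => form_smul_ee (by simp [opp]) _ _) (fun r _ => hN _)
  have hdec := eichler_decompose k h1 h2
  rw [Fintype.sum_sum_type]
  have hpp : ∀ g g' : Idx n → R, form H (posPart g) (posPart g') = 0 := fun g g' => by
    simp [posPart, form_sum_left, form_sum_right, form_smul_left, form_smul_right, form_ee_ee, opp]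
  have hnn : ∀ g g' : Idx n → R, form H (negPart g) (negPart g') = 0 := fun g g' => by
    simp [negPart, form_sum_left, form_sum_right, form_smul_left, form_smul_right, form_ee_ee, opp]
  -- `E(e_k, c e_j)` joins the positive or the negative part of `f`, depending on the sign of `j`.
  rcases j with j | j
  · rw [posPart_add, posPart_inl, add_comm (posPart f), eichler_add_right hk hcj h1
      (by rw [← posPart_inl, hpp])] at hP
    rw [negPart_add, negPart_inl, add_zero] at hQ
    have hc := eichler_ee_mem Δ hjk.symm.2 1 c
    rw [one_smul] at hc
    refine ((hQ.inv.mul (hP.inv.mul (hM.conj hc)))).mono (by omega) |>.cast_eq ?_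
    rw [hdec]
    group
  · rw [negPart_add, negPart_inr, eichler_add_right hk h2 hcj
      (by rw [← negPart_inr, hnn])] at hQ
    rw [posPart_add, posPart_inr, add_zero] at hP
    have hcomm : eichler H (ee k) (c • ee (Sum.inr j)) 0 * extra k (quad H f)
        = extra k (quad H f) * eichler H (ee k) (c • ee (Sum.inr j)) 0 := by
      rw [extra, eichler_mul _ _ hk hcj (by simp [form_smul_right]),
        eichler_mul _ _ hk (by simp [form_smul_right]) hcj, add_comm]
      congr 1
      simp [form_smul_left, form_smul_right]
    refine ((hQ.inv.mul (hP.inv.mul hM))).mono (by omega) |>.cast_eq ?_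
    rw [hdec, mul_assoc (_ * _) (extra k _), ← hcomm]
    group

end Coordinates

/-! ### A commutator in an isotropic plane -/

section Plane

variable {R : Type*} [CommRing R] {H : HermitianRing R} {n : ℕ}
variable {Δ : OddFormParameter H} {σ : GeneralLinearGroup (Idx n) R} {N M : ℕ}

attribute [local simp] form_add_left form_add_right form_sub_left form_sub_right form_neg_left
  form_neg_right form_smul_left form_smul_right form_ee_ee opp_inj opp_ne_self ne_opp_self
  opp_eq_iff

theorem eichler_smul_smul {k l : Hb n} (hkl : k ≠ opp l) (x y : R) :
    eichler H (x • ee k) (y • ee l) 0 = eichler H ((x * H.bar y) • ee k) (ee l) 0 := by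
  rw [eichler_ee_right k _ x (by simp [hkl]), eichler_ee_right k _ _ (by simp [hkl]), smul_smul,
    map_mul, H.bar_bar_eq]

/-- The vector `σ_ii σ_{*p} - σ_ip σ_{*i}`, whose coordinate `i` vanishes. -/
def planeVec (σ : GeneralLinearGroup (Idx n) R) (i p : Hb n) : Idx n → R :=
  σ.1 (some i) (some i) • act σ (ee p) - σ.1 (some i) (some p) • act σ (ee i)

theorem planeVec_apply (i p : Hb n) (r : Idx n) : planeVec σ i p r =
    σ.1 (some i) (some i) * σ.1 r (some p) - σ.1 (some i) (some p) * σ.1 r (some i) := by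
  simp [planeVec, act_ee]

theorem planeVec_eq (i p : Hb n) : planeVec σ i p = act σ (σ.1 (some i) (some i) • ee p
    + (-σ.1 (some i) (some p)) • ee i) := by
  rw [planeVec, act_add, act_smul, act_smul]
  module

theorem form_ee_planeVec (i p : Hb n) : form H (ee (opp i)) (planeVec σ i p) = 0 := by
  rw [form_ee_left, opp_opp, planeVec_apply]
  ring

/-- The minor `u_j v_m - u_m v_j` of `u = planeVec σ i j` and `v = planeVec σ i m`. -/
def planeMinor (σ : GeneralLinearGroup (Idx n) R) (i j m : Hb n) : R :=
  planeVec σ i j (some j) * planeVec σ i m (some m)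
    - planeVec σ i j (some m) * planeVec σ i m (some j)

/-- Let `u = σ_ii e_j - σ_ij e_i` and `v = σ_ii e_m - σ_im e_i`, whose images under `σ` are
`u' = planeVec σ i j` and `v' = planeVec σ i m`. The transformation `E(x u', v')` fixes `e_{-i}` and
moves a suitable vector `a` orthogonal to `u'` by a multiple of `u'`, so its commutator with
`E(e_{-i}, a)` is some `E(e_{-i}, α u')`. To obtain products of conjugates of `σ`, one multiplies
its inverse by `E(x u, v)`, or rather by `τ₁`, which arises from `E(x u, v)` by dropping factors
with controlled parameters. This accounts for the second factor. -/
theorem ProdConj.plane (hn : 3 ≤ n) (hσ : Preserves H σ) {i j m : Hb n} (hij : Indep i j)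
    (him : Indep i m) (hjm : Indep j m) (x : R) :
    ProdConj Δ σ 836
      (eichler H (ee (opp i))
          ((-(x * (H.theta m * H.theta j * H.bar (planeMinor σ i j m)))) • planeVec σ i j) 0
        * eichler H (ee (opp i)) ((x * (σ.1 (some i) (some i) * H.bar (σ.1 (some i) (some i))) *
          (H.theta m * H.theta j * H.bar (planeVec σ i j (some j)))) • ee j) 0) := by
  set ω : Hb n → R := fun q => σ.1 (some i) (some q) with hω
  set u : Idx n → R := ω i • ee j + (-ω j) • ee i with hu
  set v : Idx n → R := ω i • ee m + (-ω m) • ee i with hv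
  set u' := planeVec σ i j with hu'
  set v' := planeVec σ i m
  have hu1 : u' = act σ u := planeVec_eq i j
  have hv1 : v' = act σ v := planeVec_eq i m
  have huu : form H u u = 0 := by simp [hu, hij.all]
  have huv : form H u v = 0 := by simp [hu, hv, hij.all, him.all, hjm.all]
  have hvv : form H v v = 0 := by simp [hv, him.all]
  have huu' : form H u' u' = 0 := by rw [hu1, hσ, huu]
  have huv' : form H u' v' = 0 := by rw [hu1, hv1, hσ, huv]
  have heu : form H (ee (opp i)) u' = 0 := form_ee_planeVec i j
  have hev : form H (ee (opp i)) v' = 0 := form_ee_planeVec i m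
  set τ := eichler H (x • u) v 0 with hτ
  set τ₁ := eichler H ((x * ω i) • ee j) (ω i • ee m) 0 with hτ₁
  have hτ₁m : τ₁ ∈ elementaryGroup n Δ := eichler_ee_mem Δ hjm.2 _ _
  -- The elements `τ` and `τ₁` differ by few factors only.
  have hκ : ∃ κ, ProdConj Δ σ 96 κ ∧ τ = τ₁ * κ := by
    have c1 : ProdConj Δ σ 32 (eichler H ((x * ω i) • ee j) ((-ω m) • ee i) 0) := by
      rw [eichler_smul_smul hij.symm.2]
      refine (shortBound_row_diag (Δ := Δ) hn hσ him |>.mul (-x)) j i hij.symm.1 hij.symm.2 1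
        |>.cast_eq ?_
      congr 2
      simp only [hω, map_neg]
      ring
    have c2 : ProdConj Δ σ 32 (eichler H ((-(x * ω j)) • ee i) (ω i • ee m) 0) := by
      rw [eichler_smul_smul him.2]
      refine ((shortBound_row_diag (Δ := Δ) hn hσ hij).bar.mul (-x)) i m him.1 him.2 1
        |>.cast_eq ?_
      congr 2
      simp only [hω, map_mul, H.bar_bar_eq]
      ring
    have c3 : ProdConj Δ σ 32 (eichler H ((-(x * ω j)) • ee i) ((-ω m) • ee i) 0) := by
      rw [eichler_smul_self]
      refine ShortBound.extra_central hn (N := 16) ?_ i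
      refine ((shortBound_row_off (Δ := Δ) hn hσ hij him hjm).bar.of_eq_mul (-H.bar x)) ?_
      simp only [hω, map_mul, map_neg, H.bar_bar_eq]
      ring
    refine ⟨_, c1.mul (c2.mul c3), ?_⟩
    have e1 : x • u = (x * ω i) • ee j + (-(x * ω j)) • ee i := by rw [hu]; module
    rw [hτ, e1, hv, eichler_add_left, eichler_add_right, eichler_add_right, ← hτ₁, mul_assoc]
    all_goals simp [hij.all, him.all, hjm.all]
  obtain ⟨κ, hκ, hτκ⟩ := hκ
  have hτm : τ ∈ elementaryGroup n Δ := by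
    have e1 : x • u = (x * ω i) • ee j + (-(x * ω j)) • ee i := by rw [hu]; module
    rw [hτ, e1, hv]
    exact eichler_mem_of_two Δ hij.symm.2 him.symm.2 hjm.2 hij.symm.2 him.2 (ne_opp_self i) _ _ _ _
  set ξ := σ * τ⁻¹ * σ⁻¹ with hξ
  have hτp := preserves_of_mem_elementary hτm
  have hτ₁p := preserves_of_mem_elementary hτ₁m
  have hξp : Preserves H ξ := (hσ.mul hτp.inv).mul hσ.inv
  have p1 : ProdConj Δ σ 98 (τ₁ * ξ) := by
    have q1 : ProdConj Δ σ 2 (τ * ξ) := by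
      refine (ProdConj.pair hτm (one_mem _)).cast_eq ?_
      rw [hξ]; group
    refine ((hκ.inv.conj hτm).mul q1).cast_eq ?_
    rw [hτκ]
    group
  have hxu : form H (x • u') (-v') = 0 := by simp [huv']
  have hξe : ξ = eichler H (x • u') (-v') 0 := by
    rw [hξ, hτ, eichler_inv _ (by simp [huu]) (by simp [huv]), eichler_conj hσ, act_smul, act_neg,
      ← hu1, ← hv1, hvv]
    simp
  set A := H.bar (u' (some j)) * H.theta j with hA
  set C := H.bar (u' (some m)) * H.theta m with hC
  have hA' : form H u' (ee (opp j)) = A := by rw [form_ee_right, opp_opp]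
  have hC' : form H u' (ee (opp m)) = C := by rw [form_ee_right, opp_opp]
  set a : Idx n → R := A • ee (opp m) + (-C) • ee (opp j) with ha
  have hua : form H u' a = 0 := by
    rw [ha, form_add_right, form_smul_right, form_smul_right, hA', hC']; ring
  have hva : form H v' a = H.theta m * H.theta j * H.bar (planeMinor σ i j m) := by
    rw [ha, form_add_right, form_smul_right, form_smul_right, form_ee_right, form_ee_right,
      opp_opp, opp_opp, hA, hC, planeMinor, map_sub, map_mul, map_mul]
    ring
  have hea : form H (ee (opp i)) a = 0 := by simp [ha, hij.all, him.all]
  set α := -(x * (H.theta m * H.theta j * H.bar (planeMinor σ i j m))) with hα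
  have hξi : act ξ (ee (opp i)) = ee (opp i) := by
    rw [hξe]
    refine eichler_act_fix (by simp [huu']) hxu ?_ ?_
    · rw [form_smul_left, form_eq_zero_symm H heu, mul_zero]
    · rw [form_neg_left, form_eq_zero_symm H hev, neg_zero]
  have hξa : act ξ a = α • u' + a := by
    rw [hξe, act_eichler _ (by simp [huu']) hxu, form_smul_left, hua, form_neg_left, hva, hα]
    module
  set g₁ := eichler H (ee (opp i)) (A • ee (opp m)) 0 with hg₁
  set g₂ := eichler H (ee (opp i)) ((-C) • ee (opp j)) 0 with hg₂
  have hg₁m : g₁ ∈ elementaryGroup n Δ := by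
    simpa using eichler_ee_mem Δ him.opp_left.opp_right.2 (1 : R) A
  have hg₂m : g₂ ∈ elementaryGroup n Δ := by
    have := eichler_ee_mem Δ hij.opp_left.opp_right.2 (1 : R) (-C)
    rwa [one_smul] at this
  have hg : eichler H (ee (opp i)) a 0 = g₁ * g₂ := by
    rw [ha, hg₁, hg₂, eichler_add_right]
    all_goals simp [hij.all, him.all, hjm.symm.all]
  have hg₂P : ProdConj Δ σ 320 g₂ := by
    have b1 : ShortBound Δ σ 320 (u' (some m)) := by
      refine (((shortBound_entry hn hσ hjm.symm).mul (ω i)).add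
        ((shortBound_entry hn hσ him.symm).mul (-ω j))).of_eq_mul 1 ?_
      rw [hu', planeVec_apply]
      ring
    refine (b1.mul (-(H.bar (H.theta m)))) (opp i) (opp j) (hij.opp_left.opp_right.1)
      (hij.opp_left.opp_right.2) 1 |>.cast_eq ?_
    rw [hg₂, eichler_ee_right]
    · congr 2
      simp [hC]
      ring
    · simp [hij.all]
  set γ := -(x * (ω i * H.bar (ω i)) * (H.theta m * H.theta j * H.bar (u' (some j)))) with hγ
  have hτ₁i : act τ₁⁻¹ (ee (opp i)) = ee (opp i) := by
    apply act_inv_fix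
    refine eichler_act_fix ?_ ?_ ?_ ?_
    all_goals simp [hij.symm.all, him.symm.all, hjm.all]
  have hτ₁m' : act τ₁⁻¹ (A • ee (opp m)) = A • ee (opp m) + γ • ee j := by
    rw [hτ₁, eichler_inv, act_eichler]
    · have e1 : form H ((x * ω i) • ee j) (A • ee (opp m)) = 0 := by simp [hjm.all]
      have e2 : form H (-(ω i • ee m)) (A • ee (opp m)) = -(H.bar (ω i) * (A * H.theta m)) := by
        simp
        ring
      rw [e1, e2, hγ, hA]
      module
    all_goals simp [hjm.all]
  have hτ₁g : τ₁⁻¹ * g₁ * τ₁ = g₁ * eichler H (ee (opp i)) (γ • ee j) 0 := by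
    have h := eichler_conj hτ₁p.inv (ee (opp i)) (A • ee (opp m)) 0
    rw [inv_inv, hτ₁i, hτ₁m'] at h
    rw [hg₁, h, eichler_add_right]
    all_goals simp [hij.all, him.all, hjm.symm.all]
  have hcomm : g₁ * eichler H (ee (opp i)) (γ • ee j) 0
      = eichler H (ee (opp i)) (γ • ee j) 0 * g₁ := by
    rw [hg₁, ← eichler_add_right, ← eichler_add_right, add_comm]
    all_goals simp [hij.all, him.all, hjm.all]
  have hξg : ξ * eichler H (ee (opp i)) a 0 * ξ⁻¹
      = eichler H (ee (opp i)) (α • u') 0 * (g₁ * g₂) := by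
    rw [eichler_conj hξp, hξi, hξa, ← hg, eichler_add_right]
    · simp
    · rw [form_smul_right, heu, mul_zero]
    · exact hea
    · rw [form_smul_left, hua, mul_zero]
  have hγi : eichler H (ee (opp i)) ((x * (ω i * H.bar (ω i)) *
      (H.theta m * H.theta j * H.bar (u' (some j)))) • ee j) 0
      = (eichler H (ee (opp i)) (γ • ee j) 0)⁻¹ := by
    rw [eichler_inv, hγ]
    · congr 1 <;> simp
    all_goals simp [hij.all]
  rw [hγi]
  set E := eichler H (ee (opp i)) (γ • ee j) 0
  have hEm : E ∈ elementaryGroup n Δ := by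
    simpa using eichler_ee_mem Δ hij.opp_left.2 (1 : R) γ
  -- The commutator of `τ₁ * ξ` with `E(e_{-i}, a) = g₁ * g₂`, conjugated by `τ₁⁻¹`.
  have p2 : ProdConj Δ σ 196 (eichler H (ee (opp i)) (α • u') 0 * (g₁ * g₂)
      * (τ₁⁻¹ * (g₁ * g₂) * τ₁)⁻¹) := by
    refine ((p1.commutator (mul_mem hg₁m hg₂m)).conj_inv hτ₁m).cast_eq ?_
    rw [← hξg, hg]
    group
  -- The factor `g₂` is removed together with its conjugate.
  have p3 : ProdConj Δ σ 640 (τ₁⁻¹ * g₂ * τ₁ * g₂⁻¹) := (hg₂P.conj_inv hτ₁m).mul hg₂P.inv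
  refine (p2.mul ((p3.conj hg₁m).conj hEm)).cast_eq ?_
  have e3 : τ₁⁻¹ * (g₁ * g₂) * τ₁ = E * g₁ * (τ₁⁻¹ * g₂ * τ₁) := by
    rw [← hcomm, ← hτ₁g]
    group
  rw [e3]
  group

end Plane

/-! ### The combination of two columns -/

section Column

variable {R : Type*} [CommRing R] {H : HermitianRing R} {n : ℕ}
variable {Δ : OddFormParameter H} {σ : GeneralLinearGroup (Idx n) R} {N M : ℕ}

theorem planeMinor_eq (i j m : Hb n) : planeMinor σ i j m = σ.1 (some i) (some i) *
    (σ.1 (some i) (some i) * (σ.1 (some j) (some j) * σ.1 (some m) (some m)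
        - σ.1 (some m) (some j) * σ.1 (some j) (some m))
      - σ.1 (some i) (some m) * (σ.1 (some j) (some j) * σ.1 (some m) (some i)
        - σ.1 (some m) (some j) * σ.1 (some j) (some i))
      - σ.1 (some i) (some j) * (σ.1 (some j) (some i) * σ.1 (some m) (some m)
        - σ.1 (some m) (some i) * σ.1 (some j) (some m))) := by
  simp only [planeMinor, planeVec_apply]
  ring

theorem quad_act_ee_mem (hσ : σ ∈ unitaryGroup n Δ) (j : Hb n) :
    quad H (act σ (ee j)) ∈ Δ.carrier := by
  have h := hσ.2 (ee j)
  have h0 : quad H (ee j : Idx n → R) = 0 := by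
    rcases j with j | j <;> simp [quad, Heisenberg.zero_def, ee_apply]
  rw [h0, sub_zero] at h
  exact h

/-- The coordinates of `α • planeVec σ i j` are small if `α` is a multiple of `bar (σ i i)`, since
then `α * σ i j` is small by `shortBound_row_diag`. -/
theorem prodConj_quad_planeVec (hn : 3 ≤ n) (hσ : Preserves H σ) {i j m : Hb n} (hij : Indep i j)
    (him : Indep i m) (hjm : Indep j m) (x : R) :
    ProdConj Δ σ (384 * n + 1892) (extra (opp i) (quad H
      ((-(x * (H.theta m * H.theta j * H.bar (planeMinor σ i j m)))) • planeVec σ i j))) := by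
  have hpl := ProdConj.plane (Δ := Δ) hn hσ hij him hjm x
  set α := -(x * (H.theta m * H.theta j * H.bar (planeMinor σ i j m))) with hα
  set c := x * (σ.1 (some i) (some i) * H.bar (σ.1 (some i) (some i))) *
    (H.theta m * H.theta j * H.bar (planeVec σ i j (some j))) with hc
  set α' := -(x * (H.theta m * H.theta j)) * H.bar
    (σ.1 (some i) (some i) * (σ.1 (some j) (some j) * σ.1 (some m) (some m)
        - σ.1 (some m) (some j) * σ.1 (some j) (some m))
      - σ.1 (some i) (some m) * (σ.1 (some j) (some j) * σ.1 (some m) (some i)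
        - σ.1 (some m) (some j) * σ.1 (some j) (some i))
      - σ.1 (some i) (some j) * (σ.1 (some j) (some i) * σ.1 (some m) (some m)
        - σ.1 (some m) (some i) * σ.1 (some j) (some m))) with hα'
  have hαα' : α = α' * H.bar (σ.1 (some i) (some i)) := by
    rw [hα, planeMinor_eq, map_mul, hα']
    ring
  have hrow : ∀ p, Indep i p → ShortBound Δ σ 32
      (σ.1 (some i) (some p) * H.bar (σ.1 (some i) (some i))) := fun p hp =>
    (shortBound_row_diag hn hσ hp).bar.of_eq_mul 1 (by simp [mul_comm])
  have hcoord : ∀ (p : Hb n), α * planeVec σ i j (some p)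
      = α * σ.1 (some i) (some i) * σ.1 (some p) (some j) - α' * σ.1 (some p) (some i) *
        (σ.1 (some i) (some j) * H.bar (σ.1 (some i) (some i))) := fun p => by
    rw [planeVec_apply, hαα']; ring
  have hsmall : ∀ p K, ShortBound Δ σ K (σ.1 (some p) (some j)) →
      ShortBound Δ σ (K + 32) (α * planeVec σ i j (some p)) := by
    intro p K hK
    refine ((hK.mul (α * σ.1 (some i) (some i))).add
      ((hrow j hij).mul (-(α' * σ.1 (some p) (some i))))).of_eq_mul 1 ?_
    rw [hcoord]; ring
  -- For the coordinate `j` the main terms of `α * planeVec σ i j` and of `c` cancel.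
  have hdiag : ShortBound Δ σ 896 (α * planeVec σ i j (some j) + c) := by
    have b1 := shortBound_one_sub (Δ := Δ) hn hσ hjm
    have b2 := (shortBound_entry (Δ := Δ) hn hσ hjm).bar
    have b3 := shortBound_row_diag (Δ := Δ) hn hσ him
    have b4 := shortBound_row_diag (Δ := Δ) hn hσ hij
    have b5 := hrow j hij
    refine (((((b1.mul (x * H.theta m * H.theta j * σ.1 (some i) (some i) *
        H.bar (σ.1 (some i) (some i)) * H.bar (σ.1 (some i) (some i)) *
        H.bar (σ.1 (some j) (some j)))).add
      (b2.mul (x * H.theta m * H.theta j * σ.1 (some i) (some i) *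
        H.bar (σ.1 (some i) (some i)) * H.bar (σ.1 (some i) (some i)) * σ.1 (some j) (some j) *
        H.bar (σ.1 (some m) (some j))))).add
      (b3.mul (x * H.theta m * H.theta j * H.bar (σ.1 (some i) (some i)) * σ.1 (some j) (some j) *
        H.bar (σ.1 (some j) (some j) * σ.1 (some m) (some i)
        - σ.1 (some m) (some j) * σ.1 (some j) (some i))))).add
      (b4.mul (x * H.theta m * H.theta j * H.bar (σ.1 (some i) (some i)) *
        (σ.1 (some j) (some j) * H.bar (σ.1 (some j) (some i) * σ.1 (some m) (some m)
        - σ.1 (some m) (some i) * σ.1 (some j) (some m)) - H.bar (σ.1 (some j) (some i)))))).add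
      (b5.mul (-(α' * σ.1 (some j) (some i))))).of_eq_mul 1 ?_
    rw [hcoord, hαα', hc, hα', planeVec_apply]
    simp only [map_sub, map_mul]
    ring
  have hvec : ∀ p, (α • planeVec σ i j + c • ee j : Idx n → R) (some p)
      = α * planeVec σ i j (some p) + if p = j then c else 0 := by
    intro p
    simp [ee_apply]
  have hN : ∀ p, ProdConj Δ σ (192 + (if p = opp j then 160 else 0) + (if p = j then 704 else 0)
      + (if p = opp i then 192 else 0)) (eichler H (ee (opp i))
        ((α • planeVec σ i j + c • ee j : Idx n → R) (some p) • ee p) 0) := by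
    intro p
    rw [hvec]
    have gen : ∀ K, Indep (opp i) p → ShortBound Δ σ K
        (α * planeVec σ i j (some p) + if p = j then c else 0) → ProdConj Δ σ K
        (eichler H (ee (opp i)) ((α * planeVec σ i j (some p) + if p = j then c else 0) • ee p)
          0) := by
      intro K hp hK
      have := hK.bar (opp i) p hp.1 hp.2 1
      rwa [one_mul, eichler_ee_right _ _ _ (form_ee_ne H hp.2), H.bar_bar_eq] at this
    -- The coordinate `-i` gives a long root element, and the coordinate `i` vanishes.
    by_cases h1 : p = opp i
    · have h2 : p ≠ j := fun h => hij.symm.2 (by rw [← h, h1])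
      have b0 := hsmall p 160 (h1 ▸ shortBound_entry hn hσ hij.opp_left)
      simp only [if_neg h2, if_pos h1, add_zero]
      rw [h1]
      have h3 := eichler_smul_self (H := H) (opp i) 1 (α * planeVec σ i j (some (opp i)))
      rw [one_smul] at h3
      rw [h3]
      rw [h1] at b0
      refine (ShortBound.extra_central hn (b0.of_eq_mul (-1) ?_) (opp i)).mono (by omega)
      simp
    by_cases h2 : p = i
    · have h3 : p ≠ j := fun h => hij.1 (by rw [← h, h2])
      have h4 : planeVec σ i j (some i) = 0 := by rw [planeVec_apply]; ring
      simp only [if_neg h3]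
      rw [h2, h4]
      have : eichler H (ee (opp i)) ((α * 0 + 0) • ee i) 0 = 1 := by
        rw [mul_zero, add_zero, zero_smul, eichler_zero]
      rw [this]
      exact ProdConj.one.mono (by omega)
    have hip : Indep (opp i) p := ⟨fun h => h1 h.symm, fun h => h2 (opp_inj.1 h).symm⟩
    by_cases h3 : p = j
    · have h4 : p ≠ opp j := by rw [h3]; exact ne_opp_self j
      refine (gen 896 hip ?_).mono (by rw [if_pos h3]; omega)
      rw [if_pos h3, h3]
      exact hdiag
    by_cases h4 : p = opp j
    · refine (gen 352 hip ?_).mono (by rw [if_pos h4]; omega)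
      rw [if_neg h3, add_zero]
      refine hsmall p 320 ?_
      have := shortBound_entry_opp (Δ := Δ) hn hσ (opp j)
      rwa [opp_opp, ← h4] at this
    · refine (gen 192 hip ?_).mono (by omega)
      rw [if_neg h3, add_zero]
      exact hsmall p 160 (shortBound_entry hn hσ ⟨h3, h4⟩)
  have hf : form H (ee (opp i)) (α • planeVec σ i j) = 0 := by
    rw [form_smul_right, form_ee_planeVec, mul_zero]
  refine (ProdConj.extra_quad_of_coords hij.symm.opp_right hf c _ hpl hN).mono ?_
  simp only [Finset.sum_add_distrib, Finset.sum_ite_eq', Finset.mem_univ, if_true,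
    Finset.sum_const, Finset.card_univ, Fintype.card_sum, Fintype.card_fin, smul_eq_mul]
  omega

end Column

/-! ### Single columns -/

section ColumnQuad

variable {R : Type*} [CommRing R] {H : HermitianRing R} {n : ℕ}
variable {Δ : OddFormParameter H} {σ : GeneralLinearGroup (Idx n) R} {N M : ℕ}

/-- As `planeVec σ i j` is a combination of the columns `i` and `j` of `σ`, and the coefficient of
column `i` is small, `prodConj_quad_planeVec` yields an element belonging to column `j`. -/
theorem prodConj_quad_column_circ (hn : 3 ≤ n) (hσ : σ ∈ unitaryGroup n Δ) {i j m : Hb n}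
    (hij : Indep i j) (him : Indep i m) (hjm : Indep j m) (x : R) :
    ProdConj Δ σ (384 * n + 2052) (extra (opp i) ((quad H (act σ (ee j))).circ
      (-(x * (H.theta m * H.theta j * H.bar (planeMinor σ i j m))) * σ.1 (some i) (some i)))) := by
  have hσp := preserves_of_mem hσ
  have h0 := prodConj_quad_planeVec (Δ := Δ) hn hσp hij him hjm x
  set α := -(x * (H.theta m * H.theta j * H.bar (planeMinor σ i j m))) with hα
  set s := α * σ.1 (some i) (some i) with hs
  set t := α * σ.1 (some i) (some j) with ht
  have ht32 : ShortBound Δ σ 32 t := by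
    refine (shortBound_row_diag hn hσp hij).bar.of_eq_mul (-(x * (H.theta m * H.theta j)) * H.bar
      (σ.1 (some i) (some i) * (σ.1 (some j) (some j) * σ.1 (some m) (some m)
        - σ.1 (some m) (some j) * σ.1 (some j) (some m))
      - σ.1 (some i) (some m) * (σ.1 (some j) (some j) * σ.1 (some m) (some i)
        - σ.1 (some m) (some j) * σ.1 (some j) (some i))
      - σ.1 (some i) (some j) * (σ.1 (some j) (some i) * σ.1 (some m) (some m)
        - σ.1 (some m) (some i) * σ.1 (some j) (some m)))) ?_
    rw [ht, hα, planeMinor_eq, map_mul _ (σ.1 (some i) (some i)), map_mul _ (σ.1 (some i) (some i)),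
      H.bar_bar_eq]
    ring
  have hf : α • planeVec σ i j = s • act σ (ee j) + (-t) • act σ (ee i) := by
    rw [planeVec, hs, ht]
    module
  have hform : form H (s • act σ (ee j)) ((-t) • act σ (ee i)) = 0 := by
    rw [form_smul_left, form_smul_right, hσp, form_ee_ne H hij.symm.2, mul_zero, mul_zero]
  rw [hf, quad_add, hform, quad_smul, quad_smul] at h0
  set S := ∑ r : Fin n, H.bar (((-t) • act σ (ee i) : Idx n → R) (some (Sum.inl r))) *
    (s • act σ (ee j) : Idx n → R) (some (Sum.inr r)) with hS
  have hS32 : ShortBound Δ σ 32 S := by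
    refine ht32.bar.of_eq_mul (∑ r : Fin n, H.bar ((-act σ (ee i) : Idx n → R)
      (some (Sum.inl r))) * (s • act σ (ee j) : Idx n → R) (some (Sum.inr r))) ?_
    rw [hS, Finset.sum_mul]
    refine Finset.sum_congr rfl fun r _ => ?_
    simp only [Pi.smul_apply, Pi.neg_apply, smul_eq_mul, map_mul, map_neg]
    ring
  have p1 := hS32.extra_central hn (opp i)
  have p2 := ShortBound.extra_circ hn (ht32.mul (-1)) (quad_act_ee_mem hσ i) (M := 32)
    ((ht32.mul (-1)).bar.of_eq_mul (quad H (act σ (ee i))).snd (by ring)) (opp i)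
  refine ((h0.mul p1.inv).mul p2.inv).mono (by omega) |>.cast_eq ?_
  have hz : (⟨0, 0⟩ : Heisenberg H) = 0 := rfl
  rw [hz, add_zero, ← extra_mul, ← extra_mul, neg_one_mul]
  group

theorem shortBound_quad_snd (hn : 3 ≤ n) (hσ : Preserves H σ) (j : Hb n) :
    ShortBound Δ σ (160 * n + 160) (quad H (act σ (ee j))).snd := by
  have h : ∀ r ∈ Finset.univ, ShortBound Δ σ
      (160 + if r = (Sum.elim id id j : Fin n) then 160 else 0)
      (H.bar (act σ (ee j) (some (Sum.inl r))) * act σ (ee j) (some (Sum.inr r))) := by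
    intro r _
    rw [act_ee, act_ee]
    by_cases h1 : Sum.inl r = j
    · rw [← h1, Sum.elim_inl, id, if_pos rfl]
      exact (shortBound_entry_opp hn hσ (Sum.inr r)).mul _
    by_cases h2 : Sum.inr r = j
    · rw [← h2, Sum.elim_inr, id, if_pos rfl, mul_comm]
      exact (shortBound_entry_opp hn hσ (Sum.inl r)).bar.mul _
    · refine ((shortBound_entry hn hσ ⟨h2, fun h3 => h1 ?_⟩).mul _).mono (by omega)
      rw [← opp_opp j, ← h3]
      rfl
  refine (ShortBound.sum Finset.univ _ _ h).mono (le_of_eq ?_)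
  rw [Finset.sum_add_distrib, Finset.sum_ite_eq']
  simp
  ring

/-- The operation `∘` is additive in the scalar up to elements of the smallest form parameter. -/
theorem circ_add {p : Heisenberg H} (hp : p ∈ Δ.carrier) (s r : R) :
    p.circ (s + r) = p.circ s + p.circ r
      + ⟨0, H.bar r * s * p.snd - H.bar (H.bar r * s * p.snd) * H.lam⟩ := by
  have ht := Δ.trace_eq hp
  ext
  · simp [Heisenberg.circ, Heisenberg.add_def]
    ring
  · simp only [Heisenberg.circ, Heisenberg.add_def, map_add, map_mul, H.bar_bar_eq]
    linear_combination (H.bar s * r) * ht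

/-- The extra short root elements belonging to the columns of `σ` are products of boundedly many
conjugates, with an arbitrary additional scalar `y`. -/
theorem prodConj_quad_column (hn : 3 ≤ n) (hσ : σ ∈ unitaryGroup n Δ) (j k : Hb n) (y : R) :
    ProdConj Δ σ (864 * n + 6180) (extra k ((quad H (act σ (ee j))).circ y)) := by
  have hσp := preserves_of_mem hσ
  obtain ⟨i, hij, -⟩ := exists_indep hn j j
  obtain ⟨m, hmi, hmj⟩ := exists_indep hn i j
  have him := hmi.symm
  have hjm := hmj.symm
  refine ProdConj.extra_any hn (k := opp i) ?_ k
  -- Modulo controlled elements the minor is a product of four diagonal entries, whose conjugates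
  -- are inverse to `σ i i`. With this choice of `x` the scalar `s` is `y`, modulo
  -- controlled elements.
  set x := -(y * H.bar (H.theta m) * H.bar (H.theta j) * σ.1 (some i) (some i) *
    σ.1 (some i) (some i) * σ.1 (some i) (some i)) with hx
  have h0 := prodConj_quad_column_circ hn hσ hij him hjm x
  set s := -(x * (H.theta m * H.theta j * H.bar (planeMinor σ i j m))) * σ.1 (some i) (some i)
    with hs
  have hr : ShortBound Δ σ 1824 (y - s) := by
    have b1 := shortBound_one_sub (Δ := Δ) hn hσp hij
    have b2 := (shortBound_diag_sub (Δ := Δ) hn hσp hij).bar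
    have b3 := (shortBound_diag_sub (Δ := Δ) hn hσp hjm.symm).bar
    have b4 := shortBound_row_diag (Δ := Δ) hn hσp him
    have b5 := shortBound_row_diag (Δ := Δ) hn hσp hij
    have b6 := (shortBound_entry (Δ := Δ) hn hσp hjm).bar
    have t1 := H.theta_mul_bar m
    have t2 := H.theta_mul_bar j
    have hs' : s = y * (H.theta m * H.bar (H.theta m)) * (H.theta j * H.bar (H.theta j)) *
        σ.1 (some i) (some i) ^ 4 * H.bar (planeMinor σ i j m) := by
      rw [hs, hx]; ring
    rw [t1, t2, planeMinor_eq] at hs'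
    rw [hs']
    generalize σ.1 (some i) (some i) = a at *
    generalize σ.1 (some j) (some j) = d at *
    generalize σ.1 (some m) (some m) = c at *
    rw [map_sub] at b2 b3
    refine ((((((b1.mul (y * (1 + a * H.bar d + a ^ 2 * H.bar d ^ 2 + a ^ 3 * H.bar d ^ 3))).add
      (b2.mul (-(y * a ^ 4 * H.bar d ^ 2 * (H.bar a + H.bar d))))).add
      (b3.mul (-(y * a ^ 4 * H.bar d * H.bar a ^ 2)))).add
      (b4.mul (y * a ^ 3 * H.bar a * H.bar (d * σ.1 (some m) (some i)
        - σ.1 (some m) (some j) * σ.1 (some j) (some i))))).add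
      (b5.mul (y * a ^ 3 * H.bar a * H.bar (σ.1 (some j) (some i) * c
        - σ.1 (some m) (some i) * σ.1 (some j) (some m))))).add
      (b6.mul (y * a ^ 4 * H.bar a ^ 2 * H.bar (σ.1 (some m) (some j))))).of_eq_mul 1 ?_
    simp only [map_sub, map_mul]
    ring
  have hq := shortBound_quad_snd (Δ := Δ) hn hσp j
  have p1 := ShortBound.extra_circ hn hr (quad_act_ee_mem hσ j) (hq.mul _) (opp i)
  have p2 := (hq.mul (H.bar (y - s) * s)).extra_central hn (opp i)
  have h1 := circ_add (quad_act_ee_mem hσ j) s (y - s)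
  rw [add_sub_cancel] at h1
  rw [h1, ← extra_mul, ← extra_mul]
  exact ((h0.mul p1).mul p2).mono (by omega)

end ColumnQuad

/-! ### The central entry and the theorem -/

section Conclusion

variable {R : Type*} [CommRing R] {H : HermitianRing R} {n : ℕ}
variable {Δ : OddFormParameter H} {σ : GeneralLinearGroup (Idx n) R} {N M : ℕ}

theorem Heisenberg.add_circ (p p' : Heisenberg H) (a : R) :
    (p + p').circ a = p.circ a + p'.circ a := by
  ext
  · simp [Heisenberg.circ, Heisenberg.add_def]
    ring
  · simp [Heisenberg.circ, Heisenberg.add_def]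
    ring

theorem Heisenberg.circ_circ (p : Heisenberg H) (a c : R) :
    (p.circ a).circ c = p.circ (a * c) := by
  ext
  · simp [Heisenberg.circ, mul_assoc]
  · simp [Heisenberg.circ]
    ring

theorem ShortBound.isProductOfConjugates {z : R} (h : ShortBound Δ σ N z) (hN : Even N)
    {k l : Hb n} (hkl : k ≠ l) (hkl' : k ≠ opp l) :
    IsProductOfConjugates Δ σ N (shortRoot H k l z) := by
  have h1 := shortRoot_eq (H := H) (k := k) (l := opp l) (by rwa [opp_opp])
    (H.bar (H.theta (opp l)) * z)
  have h2 : H.bar (H.theta (opp l)) * z * H.theta (opp l) = z := by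
    linear_combination z * H.theta_mul_bar (opp l)
  rw [h2, opp_opp] at h1
  rw [h1]
  exact (h k (opp l) hkl' (by rwa [opp_opp]) _).isProductOfConjugates hN

theorem ProdConj.isProductOfConjugates_extra {k : Hb n} {p : Heisenberg H}
    (h : ProdConj Δ σ N (extra k (p.circ (-(H.lam * H.bar (H.theta k)))))) (hN : Even N) :
    IsProductOfConjugates Δ σ N (extraShortRoot H k p.fst (H.bar H.lam * H.theta k * p.snd)) := by
  rw [extraShortRoot_eq]
  exact h.isProductOfConjugates hN

/-- Conjugating `σ` by the extra short root element belonging to `-j` and to `(a, c) ∈ Δ` produces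
the parameter `(σ 0 0 - σ j j) * a` in a column of the conjugate. -/
theorem exists_prodConj_zero_sub (hn : 3 ≤ n) (hσ : σ ∈ unitaryGroup n Δ) (j k : Hb n) {a : R}
    (ha : a ∈ Δ.J) :
    ∃ p ∈ Δ.carrier, p.fst = (σ.1 none none - σ.1 (some j) (some j)) * a ∧
      ∀ y, ProdConj Δ σ (2592 * n + 20940) (extra k (p.circ y)) := by
  have hσp := preserves_of_mem hσ
  obtain ⟨c, hc⟩ := id ha
  set g := (extra (opp j) (⟨a, c⟩ : Heisenberg H))⁻¹ with hg
  have hgm : g ∈ elementaryGroup n Δ := inv_mem (extra_mem Δ hc (opp j))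
  set ρ := g * σ * g⁻¹ with hρ
  have hρm : ρ ∈ unitaryGroup n Δ :=
    mul_mem (mul_mem (elementaryGroup_le Δ hgm) hσ) (inv_mem (elementaryGroup_le Δ hgm))
  set ν := H.bar H.lam * H.theta (opp j) with hν
  set ν' := H.lam * H.bar (H.theta (opp j)) with hν'
  have hνν' : ν * ν' = 1 := by
    have t1 := H.theta_mul_bar (opp j)
    have t2 := H.lam_mul_bar_lam
    rw [hν, hν']
    linear_combination t1 + H.theta (opp j) * H.bar (H.theta (opp j)) * t2
  set ζ := ν * (σ.1 (some j) none * a) - ν * c * σ.1 (some j) (some (opp j)) with hζ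
  have h1 : act g⁻¹ (ee j) = ee j - (ν * a) • e0 + (ν * c) • ee (opp j) := by
    rw [hg, inv_inv, act_extra, opp_opp, ee_none, ee_self, hν]
    module
  have hneg : g = extra (opp j) (-(⟨a, c⟩ : Heisenberg H)) := by
    rw [hg, inv_eq_iff_mul_eq_one, extra_mul, add_neg_cancel, extra_zero]
  have h2 : ∀ w : Idx n → R, act g w none = w none + ν * a * w (some j) := by
    intro w
    rw [hneg, act_extra, opp_opp, Heisenberg.neg_def]
    simp only [Pi.add_apply, Pi.sub_apply, Pi.smul_apply, smul_eq_mul, ee_none, e0_none, hν]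
    ring
  have h3 : act ρ (ee j) none = σ.1 none (some j) + ν * c * σ.1 none (some (opp j))
      - ν * ((σ.1 none none - σ.1 (some j) (some j)) * a) - ν * a * ζ := by
    rw [hρ, act_mul, act_mul, h1, h2, act_add, act_sub, act_smul, act_smul]
    simp only [Pi.add_apply, Pi.sub_apply, Pi.smul_apply, smul_eq_mul, act_ee, act_e0, hζ]
    ring
  have hζ800 : ShortBound Δ σ 800 ζ := by
    have b1 := shortBound_column_zero (Δ := Δ) hn hσp j ha
    have b2 := shortBound_entry_opp (Δ := Δ) hn hσp j
    refine ((b1.mul ν).add (b2.mul (-(ν * c)))).of_eq_mul 1 ?_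
    rw [hζ]
    ring
  have m1 := quad_act_ee_mem hσ j
  have m2 := quad_act_ee_mem hσ (opp j)
  have m3 := quad_act_ee_mem hρm j
  refine ⟨(quad H (act σ (ee j))).circ ν' + (quad H (act σ (ee (opp j)))).circ c
    + (quad H (act ρ (ee j))).circ (-ν') + (⟨a, c⟩ : Heisenberg H).circ (-ζ), ?_, ?_, fun y => ?_⟩
  · exact add_mem (add_mem (add_mem (Δ.circ_mem _ m1 _) (Δ.circ_mem _ m2 _))
      (Δ.circ_mem _ m3 _)) (Δ.circ_mem _ hc _)
  · simp only [Heisenberg.add_def, Heisenberg.circ, quad, h3, act_ee]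
    linear_combination ((σ.1 none none - σ.1 (some j) (some j)) * a + a * ζ
      - c * σ.1 none (some (opp j))) * hνν'
  · rw [Heisenberg.add_circ, Heisenberg.add_circ, Heisenberg.add_circ, Heisenberg.circ_circ,
      Heisenberg.circ_circ, Heisenberg.circ_circ, Heisenberg.circ_circ, ← extra_mul, ← extra_mul,
      ← extra_mul]
    have b1 : ShortBound Δ σ 800 (-ζ * y) := hζ800.of_eq_mul (-y) (by ring)
    have p1 := b1.extra_circ hn hc (b1.bar.of_eq_mul c (by ring)) k
    exact ((((prodConj_quad_column hn hσ j k _).mul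
      (prodConj_quad_column hn hσ (opp j) k _)).mul
      ((prodConj_quad_column hn hρm j k _).of_conj hgm)).mul p1).mono (by omega)

end Conclusion

end OddUnitary

theorem mainTheorem2 {R : Type*} [CommRing R] (H : OddUnitary.HermitianRing R)
    (Δ : OddUnitary.OddFormParameter H) (n : ℕ) (hn : 3 ≤ n)
    (σ : Matrix.GeneralLinearGroup (OddUnitary.Idx n) R)
    (hσ : σ ∈ OddUnitary.unitaryGroup n Δ)
    (i j k l : OddUnitary.Hb n)
    (hkl : k ≠ l) (hkl_opp : k ≠ OddUnitary.opp l)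
    (hij : i ≠ j) (hij_opp : i ≠ OddUnitary.opp j)
    (a : R) (ha : a ∈ Δ.J) :
    OddUnitary.IsProductOfConjugates Δ σ 160
      (OddUnitary.shortRoot H k l (σ.1 (some i) (some j))) ∧
    OddUnitary.IsProductOfConjugates Δ σ 320
      (OddUnitary.shortRoot H k l (σ.1 (some i) (some (OddUnitary.opp i)))) ∧
    OddUnitary.IsProductOfConjugates Δ σ 480
      (OddUnitary.shortRoot H k l (σ.1 (some i) none * a)) ∧
    OddUnitary.IsProductOfConjugates Δ σ 480
      (OddUnitary.shortRoot H k l (H.bar a * H.mu * σ.1 none (some j))) ∧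
    OddUnitary.IsProductOfConjugates Δ σ 480
      (OddUnitary.shortRoot H k l (σ.1 (some i) (some i) - σ.1 (some j) (some j))) ∧
    OddUnitary.IsProductOfConjugates Δ σ 960
      (OddUnitary.shortRoot H k l (σ.1 (some i) (some i)
        - σ.1 (some (OddUnitary.opp i)) (some (OddUnitary.opp i)))) ∧
    (((OddUnitary.quad H (fun r => σ.1 r (some j))).fst,
        H.lamPow (-(((OddUnitary.eps k : ℤ) + 1) / 2))
          * (OddUnitary.quad H (fun r => σ.1 r (some j))).snd) ∈ Δ.signed (-OddUnitary.eps k) ∧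
      OddUnitary.IsProductOfConjugates Δ σ (1600 * n + 5764)
        (OddUnitary.extraShortRoot H k (OddUnitary.quad H (fun r => σ.1 r (some j))).fst
          (H.lamPow (-(((OddUnitary.eps k : ℤ) + 1) / 2))
            * (OddUnitary.quad H (fun r => σ.1 r (some j))).snd))) ∧
    ∃ x : R,
      ((σ.1 none none - σ.1 (some j) (some j)) * a, x) ∈ Δ.signed (-OddUnitary.eps k) ∧
      OddUnitary.IsProductOfConjugates Δ σ (4800 * n + 16812)
        (OddUnitary.extraShortRoot H k
          ((σ.1 none none - σ.1 (some j) (some j)) * a) x) := by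
  have hσp := OddUnitary.preserves_of_mem hσ
  have hij' : OddUnitary.Indep i j := ⟨hij, hij_opp⟩
  have hcol : (fun r => σ.1 r (some j)) = OddUnitary.act σ (OddUnitary.ee j) :=
    funext fun r => (OddUnitary.act_ee σ j r).symm
  refine ⟨?_, ?_, ?_, ?_, ?_, ?_, ⟨?_, ?_⟩, ?_⟩
  · exact (OddUnitary.shortBound_entry hn hσp hij').isProductOfConjugates (by decide) hkl hkl_opp
  · exact (OddUnitary.shortBound_entry_opp hn hσp i).isProductOfConjugates (by decide) hkl hkl_opp
  · exact (OddUnitary.shortBound_column_zero hn hσp i ha).isProductOfConjugates (by decide) hkl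
      hkl_opp
  · exact (OddUnitary.shortBound_row_zero hn hσp j ha).isProductOfConjugates (by decide) hkl
      hkl_opp
  · exact (OddUnitary.shortBound_diag_sub hn hσp hij').isProductOfConjugates (by decide) hkl
      hkl_opp
  · exact (OddUnitary.shortBound_diag_sub_opp hn hσp i).isProductOfConjugates (by decide) hkl
      hkl_opp
  · rw [hcol, OddUnitary.lamPow_extra, OddUnitary.signed_iff]
    exact OddUnitary.quad_act_ee_mem hσ j
  · rw [hcol, OddUnitary.lamPow_extra]
    exact ((OddUnitary.prodConj_quad_column hn hσ j k _).mono
      (by omega)).isProductOfConjugates_extra ⟨800 * n + 2882, by ring⟩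
  · obtain ⟨p, hp, hp1, hp2⟩ := OddUnitary.exists_prodConj_zero_sub hn hσ j k ha
    refine ⟨H.bar H.lam * H.theta k * p.snd, ?_, ?_⟩
    · rw [← hp1, OddUnitary.signed_iff]
      exact hp
    · rw [← hp1]
      exact ((hp2 _).mono (by omega)).isProductOfConjugates_extra ⟨2400 * n + 8406, by ring⟩
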